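/- **Setting.** Let $\Omega\subseteq\mathbb R^n$ be open, $I=(0,1]$; all asymptotic relations are for $\varepsilon\to0^+$, and $K\Subset\Omega$ means that $K$ is a compact subset of $\Omega$. Write $(\varepsilon\odot\phi)(x)=\varepsilon^{-n}\phi(x/\varepsilon)$ for $\phi\in\mathcal D(\mathbb R^n)$. *Special algebra.* $\mathcal E^s_M(\Omega)$ (resp. $\mathcal N^s(\Omega)$) is the set of nets $(u_\varepsilon)\in C^\infty(\Omega)^I$ such that for all $K\Subset\Omega$ and $\alpha\in\mathbb N^n$ one has $\sup_K|\partial^\alpha u_\varepsilon|=O(\varepsilon^{-N})$ for some $N\in\mathbb N$ (resp. $=O(\varepsilon^{m})$ for all $m\in\mathbb N$). Put $\mathcal G^s(\Omega)=\mathcal E^s_M(\Omega)/\mathcal N^s(\Omega)$. *Full algebra.* $\mathcal A_0=\{\phi\in\mathcal D(\mathbb R^n):\int\phi=1\}$, $\mathcal A_q=\{\phi\in\mathcal A_0:\int x^\alpha\phi(x)\,dx=0\text{ for }1\le|\alpha|\le q\}$, $\Omega_\phi=\{x\in\Omega:\operatorname{supp}\phi\subseteq\Omega-x\}$, $U(\Omega)=\{(\phi,x):\phi\in\mathcal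 A_0,\ x\in\Omega_\phi\}$, and $\mathcal E^e(\Omega)$ is the set of $R:U(\Omega)\to\mathbb R$ with $R(\phi,-)\in C^\infty(\Omega_\phi)$ for all $\phi\in\mathcal A_0$. $\mathcal E^e_M(\Omega)$ is the set of $R\in\mathcal E^e(\Omega)$ such that $\forall K\Subset\Omega\ \forall\alpha\ \exists N\ \forall\phi\in\mathcal A_N:\ \sup_{x\in K}|\partial_x^\alpha R(\varepsilon\odot\phi,x)|=O(\varepsilon^{-N})$; $\mathcal N^e(\Omega)$ is the set of those with $\forall K\ \forall\alpha\ \forall m\ \exists q\ \forall\phi\in\mathcal A_q:\ \sup_{x\in K}|\partial_x^\alpha R(\varepsilon\odot\phi,x)|=O(\varepsilon^{m})$. Put $\mathcal G^e(\Omega)=\mathcal E^e_M(\Omega)/\mathcal N^e(\Omega)$. *Diffeologies.* $C^\infty(\Omega)=C^\infty(\Omega,\mathbb R)$ carries the functional diffeology, $C^\infty(\Omega)^I$ the product diffeology, and $\mathcal E^s_M(\Omega)$ the sub-diffeology of it. $U(\Omega)$ carries the sub-diffeology of $\mathcal A_0\times\mathbb R^n$ with $\mathcal A_0$ discrete, and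 $\mathcal E^e_M(\Omega)\subseteq\mathcal E^e(\Omega)\subseteq C^\infty(U(\Omega),\mathbb R)$ carry the sub-diffeologies of the functional diffeology. $\mathcal G^s(\Omega)$ and $\mathcal G^e(\Omega)$ carry the quotient diffeologies. $\mathcal D(\Omega)$ carries the canonical diffeology of its locally convex topology (plots are the maps that become smooth after composition with every continuous linear functional), and the set of distributions $\mathcal D'(\Omega)$ carries the sub-diffeology of $C^\infty(\mathcal D(\Omega),\mathbb R)$. The $D$-topology of a diffeological space is the final topology induced by its plots. **Theorem.** Let $\mathcal G(\Omega)$ be $\mathcal G^s(\Omega)$ or $\mathcal G^e(\Omega)$. 1. The sum and the product $\mathcal G(\Omega)\times\mathcal G(\Omega)\to\mathcal G(\Omega)$ and the derivations $\partial^\alpha:\mathcal G(\Omega)\to\mathcal G(\Omega)$, $\alpha\in\mathbb N^n$, are smooth. 2. With the $D$-topology, $\mathcal G(\Omega)$ is a topological $\mathbb R$-algebra, and all $\partial^\alpha$ are continuous. 3. Let $(\psi_\varepsilon)_{\varepsilon\in I}$ be a net in $\mathcal D(\mathbb R^n)$ such that: (i) $|x|<1$ for all $\varepsilon$ and all $x\in\operatorname{supp}\psi_\varepsilon$;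 (ii) $\int\psi_\varepsilon=1$ for all $\varepsilon$; (iii) for all $\alpha$ there is $N$ with $\sup_{\mathbb R^n}|\partial^\alpha\psi_\varepsilon|=O(\varepsilon^{-N})$; (iv) for all $j\in\mathbb N$ there is $\varepsilon_0$ such that $\int x^\alpha\psi_\varepsilon(x)\,dx=0$ for all $\varepsilon\le\varepsilon_0$ and $1\le|\alpha|\le j$; (v) for all $\eta>0$ there is $\varepsilon_0$ with $\int|\psi_\varepsilon|\le1+\eta$ for $\varepsilon\le\varepsilon_0$. For $u\in\mathcal D'(\Omega)$ there is exactly one element $\iota_\Omega(u)=[u*(\varepsilon\odot\psi_\varepsilon)|_\Omega]$ of $\mathcal G^s(\Omega)$ having a moderate representative $(v_\varepsilon)$ such that for every $K\Subset\Omega$ and all sufficiently small $\varepsilon$ one has, for all $x\in K$, that $y\mapsto(\varepsilon\odot\psi_\varepsilon)(x-y)$ lies in $\mathcal D(\Omega)$ and $v_\varepsilon(x)=\langle u,(\varepsilon\odot\psi_\varepsilon)(x-\cdot)\rangle$. The canonical embedding $\iota_\Omega:\mathcal D'(\Omega)\to\mathcal G^s(\Omega)$ so defined is smooth. 4. For $u\in\mathcal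 D'(\Omega)$ the function $(\phi,x)\mapsto\langle u,\phi(\cdot-x)\rangle$ on $U(\Omega)$ belongs to $\mathcal E^e_M(\Omega)$, and the canonical embedding $\iota_\Omega:\mathcal D'(\Omega)\to\mathcal G^e(\Omega)$ sending $u$ to its class is smooth. 5. The canonical embeddings $\sigma_\Omega:C^\infty(\Omega)\to\mathcal G^s(\Omega)$, $f\mapsto[(f)_{\varepsilon\in I}]$, and $\sigma_\Omega:C^\infty(\Omega)\to\mathcal G^e(\Omega)$, $f\mapsto[(\phi,x)\mapsto f(x)]$, are smooth. -/

import Mathlib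

open Set Filter Topology MeasureTheory TopologicalSpace Diffeology
open scoped ContDiff Distributions

noncomputable section

namespace Colombeau

/-- The Euclidean space `ℝⁿ`. -/
abbrev Eucl (n : ℕ) := EuclideanSpace ℝ (Fin n)

/-! ### Constructions of diffeologies -/

section Diffeologies

variable {X Y : Type*}

/-- A smooth map of a Euclidean space into a prescribed open set, equal to the identity near a
prescribed point. -/
lemma exists_smooth_retraction {n : ℕ} {u : Set (Eucl n)} (hu : IsOpen u) {x : Eucl n}
    (hx : x ∈ u) : ∃ f : Eucl n → Eucl n, ContDiff ℝ ∞ f ∧ (∀ y, f y ∈ u) ∧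
      ∀ᶠ y in 𝓝 x, f y = y := by
  obtain ⟨ε, hε, hεu⟩ := Metric.isOpen_iff.mp hu x hx
  let χ : ContDiffBump x := ⟨ε / 4, ε / 2, by positivity, by linarith⟩
  refine ⟨fun y ↦ x + χ y • (y - x), ?_, fun y ↦ hεu ?_, ?_⟩
  · exact contDiff_const.add (χ.contDiff.smul (contDiff_id.sub contDiff_const))
  · rw [Metric.mem_ball, dist_eq_norm, add_sub_cancel_left, norm_smul, Real.norm_of_nonneg χ.nonneg]
    by_cases h : χ.rOut ≤ dist y x
    · rw [χ.zero_of_le_dist h, zero_mul]; exact hε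
    · have h1 : dist y x < ε / 2 := not_le.mp h
      rw [dist_eq_norm] at h1
      calc χ y * ‖y - x‖ ≤ 1 * ‖y - x‖ := by gcongr; exact χ.le_one
        _ < ε := by linarith
  · filter_upwards [χ.eventuallyEq_one] with y hy
    simp [hy]

/-- The initial diffeology of a single map `f`: a map is a plot iff its composition with `f` is.
For an inclusion this is the sub-diffeology. -/
@[reducible] def inducedDiffeology (f : X → Y) (d : DiffeologicalSpace Y) :
    DiffeologicalSpace X where
  plots k := {p | IsPlot (f ∘ p)}
  constant_plots x := isPlot_const
  plot_reparam hp hf := isPlot_reparam hp hf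
  locality h := d.locality fun x ↦ by
    obtain ⟨u, hu, hxu, h'⟩ := h x
    exact ⟨u, hu, hxu, fun hfu hf ↦ h' hfu hf⟩

/-- The product diffeology on a product of two diffeological spaces. -/
instance prodDiffeology [DiffeologicalSpace X] [DiffeologicalSpace Y] :
    DiffeologicalSpace (X × Y) where
  plots k := {p | IsPlot (fun t ↦ (p t).1) ∧ IsPlot (fun t ↦ (p t).2)}
  constant_plots x := ⟨isPlot_const, isPlot_const⟩
  plot_reparam hp hf := ⟨isPlot_reparam hp.1 hf, isPlot_reparam hp.2 hf⟩
  locality h := by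
    refine ⟨DiffeologicalSpace.locality fun x ↦ ?_, DiffeologicalSpace.locality fun x ↦ ?_⟩ <;>
      obtain ⟨u, hu, hxu, h'⟩ := h x
    · exact ⟨u, hu, hxu, fun hfu hf ↦ (h' hfu hf).1⟩
    · exact ⟨u, hu, hxu, fun hfu hf ↦ (h' hfu hf).2⟩

/-- The product diffeology on an arbitrary product of diffeological spaces. -/
@[reducible] def piDiffeology {ι : Type*} (F : ι → Type*) [∀ i, DiffeologicalSpace (F i)] :
    DiffeologicalSpace (∀ i, F i) where
  plots k := {p | ∀ i, IsPlot (fun t ↦ p t i)}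
  constant_plots x := fun _ ↦ isPlot_const
  plot_reparam hp hf := fun i ↦ isPlot_reparam (hp i) hf
  locality h := fun i ↦ DiffeologicalSpace.locality fun x ↦ by
    obtain ⟨u, hu, hxu, h'⟩ := h x
    exact ⟨u, hu, hxu, fun hfu hf ↦ h' hfu hf i⟩

/-- The discrete diffeology: the plots are the locally constant maps. -/
@[reducible] def discreteDiffeology (X : Type*) : DiffeologicalSpace X where
  plots k := {p | IsLocallyConstant p}
  constant_plots x := IsLocallyConstant.const x
  plot_reparam hp hf := hp.comp_continuous hf.continuous
  locality {k p} h := by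
    refine (IsLocallyConstant.iff_eventually_eq p).mpr fun x ↦ ?_
    obtain ⟨u, hu, hxu, h'⟩ := h x
    obtain ⟨f, hf, hfu, hfx⟩ := exists_smooth_retraction hu hxu
    filter_upwards [(IsLocallyConstant.iff_eventually_eq _).mp (h' hfu hf) x, hfx] with y hy hy'
    have := hfx.self_of_nhds
    simp only [Function.comp_apply, this, hy'] at hy
    exact hy

/-- The quotient diffeology along a surjection `π`: the maps that locally lift to plots of `X`.
(A plot defined near `x` agrees, on a smaller neighbourhood of `x`, with one defined on the whole
Euclidean space.) -/
@[reducible] def quotientDiffeology [DiffeologicalSpace X] (π : X → Y)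
    (hπ : Function.Surjective π) : DiffeologicalSpace Y where
  plots k := {p | ∀ x, ∃ δ : Eucl k → X, IsPlot δ ∧ ∀ᶠ y in 𝓝 x, p y = π (δ y)}
  constant_plots y := fun _ ↦ by
    obtain ⟨x, rfl⟩ := hπ y
    exact ⟨fun _ ↦ x, isPlot_const, Eventually.of_forall fun _ ↦ rfl⟩
  plot_reparam hp hf := fun x ↦ by
    obtain ⟨δ, hδ, h⟩ := hp (_)
    exact ⟨_, isPlot_reparam hδ hf, hf.continuous.continuousAt.eventually h⟩
  locality {k p} h := fun x ↦ by
    obtain ⟨u, hu, hxu, h'⟩ := h x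
    obtain ⟨f, hf, hfu, hfx⟩ := exists_smooth_retraction hu hxu
    obtain ⟨δ, hδ, h''⟩ := h' hfu hf x
    refine ⟨δ, hδ, ?_⟩
    filter_upwards [hfx, h''] with y hy hy'
    simpa [hy] using hy'

/-- The quotient diffeology is the smallest diffeology for which the projection is smooth. -/
lemma quotientDiffeology_le_iff [DiffeologicalSpace X] (π : X → Y) (hπ : Function.Surjective π)
    (d : DiffeologicalSpace Y) :
    quotientDiffeology π hπ ≤ d ↔ @DSmooth X Y _ d π := by
  rw [DiffeologicalSpace.le_iff']
  refine ⟨fun h n p hp ↦ h n _ fun x ↦ ⟨p, hp, Eventually.of_forall fun _ ↦ rfl⟩,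
    fun h n p hp ↦ d.locality fun x ↦ ?_⟩
  obtain ⟨δ, hδ, h'⟩ := hp x
  obtain ⟨u, hu, huo, hxu⟩ := eventually_nhds_iff.mp h'
  refine ⟨u, huo, hxu, fun {m f} hfu hf ↦ ?_⟩
  have : p ∘ f = π ∘ (δ ∘ f) := funext fun y ↦ hu _ (hfu y)
  rw [this]
  exact h _ _ (isPlot_reparam hδ hf)

/-- The set `C^∞(X, Y)` of smooth maps between diffeological spaces. -/
@[ext] structure DMap (X Y : Type*) [DiffeologicalSpace X] [DiffeologicalSpace Y] where
  toFun : X → Y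
  smooth : DSmooth toFun

/-- The functional diffeology on `C^∞(X, Y)`: `p` is a plot iff `(t, x) ↦ p t x` is smooth. -/
instance functionalDiffeology [DiffeologicalSpace X] [DiffeologicalSpace Y] :
    DiffeologicalSpace (DMap X Y) where
  plots k := {p | DSmooth (fun z : Eucl k × X ↦ (p z.1).toFun z.2)}
  constant_plots f := fun n q hq ↦ f.smooth n _ hq.2
  plot_reparam {k m p f} hp hf := fun n q hq ↦
    hp n (fun t ↦ (f (q t).1, (q t).2)) ⟨hf.dSmooth _ _ hq.1, hq.2⟩
  locality {k p} h := fun n q hq ↦ DiffeologicalSpace.locality fun x ↦ by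
    obtain ⟨u, hu, hxu, h'⟩ := h (q x).1
    have hq1 : ContDiff ℝ ∞ (fun t ↦ (q t).1) := hq.1.contDiff
    refine ⟨_, hu.preimage hq1.continuous, hxu, fun {m f} hfu hf ↦ ?_⟩
    exact h' (f := fun s ↦ (q (f s)).1) hfu (hq1.comp hf) m (fun s ↦ (s, (q (f s)).2))
      ⟨isPlot_id, isPlot_reparam hq.2 hf⟩

/-- The canonical diffeology of a topological vector space: the plots are the maps that are smooth
when tested by the continuous linear functionals. -/
@[reducible] def canonicalDiffeology (V : Type*) [AddCommGroup V] [Module ℝ V]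
    [TopologicalSpace V] : DiffeologicalSpace V where
  plots k := {p | ∀ l : V →L[ℝ] ℝ, ContDiff ℝ ∞ (fun t ↦ l (p t))}
  constant_plots v := fun _ ↦ contDiff_const
  plot_reparam hp hf := fun l ↦ (hp l).comp hf
  locality {k p} h := fun l ↦ by
    refine IsPlot.contDiff (DiffeologicalSpace.locality fun x ↦ ?_)
    obtain ⟨u, hu, hxu, h'⟩ := h x
    exact ⟨u, hu, hxu, fun hfu hf ↦ ContDiff.isPlot (h' hfu hf l)⟩

end Diffeologies

/-! ### Smooth functions on an open set and their partial derivatives -/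

section SmoothFunctions

variable {n : ℕ}

/-- An open subset of `ℝⁿ` with its standard diffeology. -/
instance (O : Opens (Eucl n)) : DiffeologicalSpace O :=
  inducedDiffeology Subtype.val inferInstance

open Classical in
/-- Extension of a function on `O` by zero. -/
def ext {O : Opens (Eucl n)} (f : O → ℝ) (x : Eucl n) : ℝ := if h : x ∈ O then f ⟨x, h⟩ else 0

lemma ext_of_mem {O : Opens (Eucl n)} (f : O → ℝ) {x : Eucl n} (h : x ∈ O) :
    ext f x = f ⟨x, h⟩ := dif_pos h

/-- The algebra `C^∞(O)` of smooth real functions on the open set `O`. -/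
def SmoothFn (O : Opens (Eucl n)) : Subalgebra ℝ (O → ℝ) where
  carrier := {f | ContDiffOn ℝ ∞ (ext f) O}
  mul_mem' {f g} hf hg := (ContDiffOn.mul hf hg).congr fun x hx ↦ by
    simp [ext_of_mem _ (show x ∈ O from hx)]
  add_mem' {f g} hf hg := (ContDiffOn.add hf hg).congr fun x hx ↦ by
    simp [ext_of_mem _ (show x ∈ O from hx)]
  algebraMap_mem' r := (contDiffOn_const (c := r)).congr fun x hx ↦ by
    rw [ext_of_mem _ (show x ∈ O from hx)]; rfl

lemma contDiffAt_ext {O : Opens (Eucl n)} (f : SmoothFn O) {x : Eucl n} (hx : x ∈ O) :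
    ContDiffAt ℝ ∞ (ext f.1) x :=
  (f.2 x hx).contDiffAt (O.isOpen.mem_nhds hx)

lemma differentiableAt_ext {O : Opens (Eucl n)} (f : SmoothFn O) {x : Eucl n} (hx : x ∈ O) :
    DifferentiableAt ℝ (ext f.1) x :=
  (contDiffAt_ext f hx).differentiableAt (by simp)

lemma dSmooth_smoothFn {O : Opens (Eucl n)} (f : SmoothFn O) : DSmooth f.1 := fun k p hp ↦ by
  have hp' : ContDiff ℝ ∞ (fun t ↦ (p t : Eucl n)) := IsPlot.contDiff hp
  refine ContDiff.isPlot ?_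
  have := ContDiffOn.comp_contDiff f.2 hp' fun t ↦ (p t).2
  have e : f.1 ∘ p = ext f.1 ∘ fun t ↦ (p t : Eucl n) :=
    funext fun t ↦ (ext_of_mem _ (p t).2).symm
  exact e ▸ this

/-- `C^∞(O)` carries the functional diffeology of `C^∞(O, ℝ)`. -/
instance (O : Opens (Eucl n)) : DiffeologicalSpace (SmoothFn O) :=
  inducedDiffeology (fun f : SmoothFn O ↦ (⟨f.1, dSmooth_smoothFn f⟩ : DMap O ℝ)) inferInstance

/-- The first order partial derivative `∂ᵢ` on `C^∞(O)`. -/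
def pderiv {O : Opens (Eucl n)} (i : Fin n) : Module.End ℝ (SmoothFn O) where
  toFun f := ⟨fun x ↦ fderiv ℝ (ext f.1) x (EuclideanSpace.single i 1), by
    have h := (ContDiffOn.fderiv_of_isOpen f.2 O.isOpen (m := ∞) (by simp)).clm_apply
      (contDiffOn_const (c := EuclideanSpace.single i (1 : ℝ)))
    exact h.congr fun x hx ↦ ext_of_mem _ hx⟩
  map_add' f g := by
    ext x
    have : ext (f + g).1 =ᶠ[𝓝 (x : Eucl n)] ext f.1 + ext g.1 := by
      filter_upwards [O.isOpen.mem_nhds x.2] with y hy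
      simp [ext_of_mem _ (show y ∈ O from hy)]
    change fderiv ℝ (ext (f + g).1) x _ = fderiv ℝ (ext f.1) x _ + fderiv ℝ (ext g.1) x _
    rw [this.fderiv_eq, fderiv_add (differentiableAt_ext f x.2) (differentiableAt_ext g x.2)]
    rfl
  map_smul' c f := by
    ext x
    have : ext (c • f).1 =ᶠ[𝓝 (x : Eucl n)] c • ext f.1 := by
      filter_upwards [O.isOpen.mem_nhds x.2] with y hy
      simp [ext_of_mem _ (show y ∈ O from hy)]
    change fderiv ℝ (ext (c • f).1) x _ = c • fderiv ℝ (ext f.1) x _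
    rw [this.fderiv_eq, fderiv_const_smul (differentiableAt_ext f x.2)]
    rfl

/-- The partial derivative `∂^α = ∂₁^α₁ ⋯ ∂ₙ^αₙ` on `C^∞(O)`. -/
def mderiv {O : Opens (Eucl n)} (α : Fin n → ℕ) : Module.End ℝ (SmoothFn O) :=
  ((List.finRange n).map fun i ↦ pderiv i ^ α i).prod

lemma pderiv_mul {O : Opens (Eucl n)} (i : Fin n) (f g : SmoothFn O) :
    pderiv i (f * g) = f * pderiv i g + pderiv i f * g := by
  ext x
  have : ext (f * g).1 =ᶠ[𝓝 (x : Eucl n)] ext f.1 * ext g.1 := by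
    filter_upwards [O.isOpen.mem_nhds x.2] with y hy
    simp [ext_of_mem _ (show y ∈ O from hy)]
  change fderiv ℝ (ext (f * g).1) x _ = f.1 x * fderiv ℝ (ext g.1) x _
    + fderiv ℝ (ext f.1) x _ * g.1 x
  rw [this.fderiv_eq, fderiv_mul (differentiableAt_ext f x.2) (differentiableAt_ext g x.2)]
  simp [ext_of_mem _ x.2, mul_comm]

lemma pderiv_algebraMap {O : Opens (Eucl n)} (i : Fin n) (r : ℝ) :
    pderiv i (algebraMap ℝ (SmoothFn O) r) = 0 := by
  ext x
  have : ext (algebraMap ℝ (SmoothFn O) r).1 =ᶠ[𝓝 (x : Eucl n)] fun _ ↦ r := by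
    filter_upwards [O.isOpen.mem_nhds x.2] with y hy
    rw [ext_of_mem _ (show y ∈ O from hy)]; rfl
  change fderiv ℝ (ext (algebraMap ℝ (SmoothFn O) r).1) x _ = 0
  rw [this.fderiv_eq]; simp

lemma pderiv_comm {O : Opens (Eucl n)} (i j : Fin n) :
    Commute (pderiv i : Module.End ℝ (SmoothFn O)) (pderiv j) := by
  ext f x
  have key : ∀ k l : Fin n, (pderiv k (pderiv l f)).1 x
      = fderiv ℝ (fderiv ℝ (ext f.1)) x (EuclideanSpace.single k 1)
        (EuclideanSpace.single l 1) := fun k l ↦ by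
    have : ext (pderiv l f).1 =ᶠ[𝓝 (x : Eucl n)]
        fun y ↦ fderiv ℝ (ext f.1) y (EuclideanSpace.single l 1) := by
      filter_upwards [O.isOpen.mem_nhds x.2] with y hy
      exact ext_of_mem _ hy
    change fderiv ℝ (ext (pderiv l f).1) x _ = _
    have hd : DifferentiableAt ℝ (fderiv ℝ (ext f.1)) x :=
      ((contDiffAt_ext f x.2).fderiv_right (m := 1) (by norm_cast)).differentiableAt (by simp)
    rw [this.fderiv_eq, fderiv_clm_apply hd (differentiableAt_const _)]
    simp
  have hs : IsSymmSndFDerivAt ℝ (ext f.1) x :=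
    (contDiffAt_ext f x.2).isSymmSndFDerivAt (by simp; norm_cast)
  exact (key i j).trans ((hs.eq _ _).trans (key j i).symm)

/-- Restriction of smooth functions to a smaller open set. -/
def restrictFn {O O' : Opens (Eucl n)} (h : O' ≤ O) (f : SmoothFn O) : SmoothFn O' :=
  ⟨fun x ↦ f.1 ⟨x, h x.2⟩, (ContDiffOn.mono f.2 h).congr fun x hx ↦ by
    rw [ext_of_mem _ (show x ∈ O' from hx), ext_of_mem _ (h hx)]⟩

lemma pderiv_restrict {O O' : Opens (Eucl n)} (h : O' ≤ O) (i : Fin n) (f : SmoothFn O) :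
    pderiv i (restrictFn h f) = restrictFn h (pderiv i f) := by
  ext x
  have : ext (restrictFn h f).1 =ᶠ[𝓝 (x : Eucl n)] ext f.1 := by
    filter_upwards [O'.isOpen.mem_nhds x.2] with y hy
    rw [ext_of_mem _ (show y ∈ O' from hy), ext_of_mem _ (h hy)]; rfl
  change fderiv ℝ (ext (restrictFn h f).1) x _ = fderiv ℝ (ext f.1) x _
  rw [this.fderiv_eq]

end SmoothFunctions

/-! ### Nets of smooth functions -/

section Nets

variable {n : ℕ} {J : Type*}

/-- Families of smooth functions `u j ∈ C^∞(O j)`, with the pointwise operations. -/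
abbrev Nets (O : J → Opens (Eucl n)) : Type _ := ∀ j, SmoothFn (O j)

variable {O : J → Opens (Eucl n)}

/-- The derivative `∂^α` of a family of smooth functions, computed in each member. -/
def netDeriv (α : Fin n → ℕ) (u : Nets O) : Nets O := fun j ↦ mderiv α (u j)

/-- Iterated first order partial derivatives along a word of indices. -/
def wordDeriv (l : List (Fin n)) : Module.End ℝ (Nets O) where
  toFun u := fun j ↦ (l.map fun i ↦ (pderiv i : Module.End ℝ (SmoothFn (O j)))).prod (u j)
  map_add' _ _ := funext fun _ ↦ map_add _ _ _
  map_smul' c u := funext fun j ↦ LinearMap.map_smul _ c (u j)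

/-- The first order partial derivative of a family of smooth functions. -/
def netPderiv (i : Fin n) : Module.End ℝ (Nets O) := wordDeriv [i]

lemma wordDeriv_append (l m : List (Fin n)) (u : Nets O) :
    wordDeriv (l ++ m) u = wordDeriv l (wordDeriv m u) := by
  funext j; simp [wordDeriv]

lemma wordDeriv_concat (l : List (Fin n)) (i : Fin n) (u : Nets O) :
    wordDeriv (l ++ [i]) u = wordDeriv l (netPderiv i u) := wordDeriv_append l [i] u

lemma wordDeriv_perm {l m : List (Fin n)} (h : l.Perm m) (u : Nets O) :
    wordDeriv l u = wordDeriv m u := by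
  funext j
  have : (l.map fun i ↦ (pderiv i : Module.End ℝ (SmoothFn (O j)))).prod
      = (m.map fun i ↦ (pderiv i : Module.End ℝ (SmoothFn (O j)))).prod :=
    (h.map _).prod_eq' (List.pairwise_map.mpr (List.pairwise_of_forall fun _ _ ↦ pderiv_comm _ _))
  simp [wordDeriv, this]

lemma netPderiv_mul (i : Fin n) (u v : Nets O) :
    netPderiv i (u * v) = u * netPderiv i v + netPderiv i u * v := by
  funext j; simp [netPderiv, wordDeriv, pderiv_mul]

/-- The word of indices that belongs to the multi-index `α`. -/
def multiWord (α : Fin n → ℕ) : List (Fin n) :=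
  (List.finRange n).flatMap fun i ↦ List.replicate (α i) i

lemma netDeriv_eq (α : Fin n → ℕ) (u : Nets O) : netDeriv α u = wordDeriv (multiWord α) u := by
  funext j
  have : ∀ L : List (Fin n), (L.map fun i ↦ (pderiv i ^ α i : Module.End ℝ (SmoothFn (O j)))).prod
      = ((L.flatMap fun i ↦ List.replicate (α i) i).map
        fun i ↦ (pderiv i : Module.End ℝ (SmoothFn (O j)))).prod := fun L ↦ by
    induction L with
    | nil => rfl
    | cons a L ih => simp [ih]
  simp [netDeriv, mderiv, wordDeriv, multiWord, this]

lemma wordDeriv_eq (l : List (Fin n)) (u : Nets O) :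
    wordDeriv l u = netDeriv (fun i ↦ l.count i) u := by
  rw [netDeriv_eq]
  refine wordDeriv_perm (List.perm_iff_count.mpr fun a ↦ ?_) u
  have : ∀ (α : Fin n → ℕ) (L : List (Fin n)), L.Nodup →
      (L.flatMap fun i ↦ List.replicate (α i) i).count a = if a ∈ L then α a else 0 := by
    intro α L hL
    induction L with
    | nil => simp
    | cons b L ih =>
      rw [List.nodup_cons] at hL
      rw [List.flatMap_cons, List.count_append, ih hL.2, List.count_replicate]
      by_cases hab : b = a
      · subst hab; simp [hL.1]
      · have hab' : a ≠ b := fun h ↦ hab h.symm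
        simp [hab, hab']
  simp [multiWord, this _ _ (List.nodup_finRange n)]

lemma forall_netDeriv_iff (P : Nets O → Prop) (u : Nets O) :
    (∀ α, P (netDeriv α u)) ↔ ∀ l, P (wordDeriv l u) :=
  ⟨fun h l ↦ wordDeriv_eq l u ▸ h _, fun h α ↦ netDeriv_eq α u ▸ h _⟩

lemma forall_netDeriv_add {P : Nets O → Prop} (hadd : ∀ a b, P a → P b → P (a + b))
    {u v : Nets O} (hu : ∀ α, P (netDeriv α u)) (hv : ∀ α, P (netDeriv α v)) (α : Fin n → ℕ) :
    P (netDeriv α (u + v)) := by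
  have h1 := hu α
  have h2 := hv α
  rw [netDeriv_eq] at h1 h2 ⊢
  rw [map_add]
  exact hadd _ _ h1 h2

lemma forall_netDeriv_mul {P Q R : Nets O → Prop} (hadd : ∀ a b, R a → R b → R (a + b))
    (hmul : ∀ a b, P a → Q b → R (a * b)) {u v : Nets O} (hu : ∀ α, P (netDeriv α u))
    (hv : ∀ α, Q (netDeriv α v)) : ∀ α, R (netDeriv α (u * v)) := by
  rw [forall_netDeriv_iff] at hu hv ⊢
  intro l
  induction l using List.reverseRecOn generalizing u v with
  | nil => exact hmul _ _ (hu []) (hv [])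
  | append_singleton l i ih =>
    rw [wordDeriv_concat, netPderiv_mul, map_add]
    refine hadd _ _ (ih hu fun m ↦ ?_) (ih (fun m ↦ ?_) hv)
    · rw [← wordDeriv_concat]; exact hv _
    · rw [← wordDeriv_concat]; exact hu _

lemma forall_netDeriv_netDeriv {P : Nets O → Prop} {u : Nets O} (hu : ∀ α, P (netDeriv α u))
    (β : Fin n → ℕ) : ∀ α, P (netDeriv α (netDeriv β u)) := by
  rw [forall_netDeriv_iff] at hu ⊢
  intro l
  rw [netDeriv_eq, ← wordDeriv_append]
  exact hu _

lemma forall_netDeriv_algebraMap {P : Nets O → Prop} (hP : ∀ r, P (algebraMap ℝ (Nets O) r))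
    (r : ℝ) : ∀ α, P (netDeriv α (algebraMap ℝ (Nets O) r)) := by
  rw [forall_netDeriv_iff]
  have h0 : ∀ l : List (Fin n), ∀ i, wordDeriv (l ++ [i]) (algebraMap ℝ (Nets O) r)
      = algebraMap ℝ (Nets O) 0 := fun l i ↦ by
    have : netPderiv i (algebraMap ℝ (Nets O) r) = 0 := by
      funext j; simp [netPderiv, wordDeriv, Pi.algebraMap_apply, pderiv_algebraMap]
    rw [wordDeriv_concat, this, map_zero, map_zero]
  intro l
  induction l using List.reverseRecOn with
  | nil => exact hP r
  | append_singleton l i _ => rw [h0]; exact hP 0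

lemma netDeriv_add (α : Fin n → ℕ) (u v : Nets O) :
    netDeriv α (u + v) = netDeriv α u + netDeriv α v := by
  simp [netDeriv_eq]

end Nets

/-! ### Asymptotic estimates on compact sets -/

section Asymptotics

variable {n : ℕ}

/-- The index set `I = (0, 1]`. -/
abbrev EpsI := Set.Ioc (0 : ℝ) 1

/-- The filter `ε → 0⁺` on `I`. -/
def zeroI : Filter EpsI := comap Subtype.val (𝓝 (0 : ℝ))

/-- `sup_{x ∈ K} |v_ε(x)| = O(ε^k)` as `ε → 0⁺`. (The domain of `v_ε` may depend on `ε`.) -/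
def IsBigOOn {O : EpsI → Opens (Eucl n)} (K : Set (Eucl n)) (v : Nets O) (k : ℤ) : Prop :=
  ∃ C : ℝ, ∀ᶠ ε in zeroI, ∀ x : O ε, (x : Eucl n) ∈ K → |(v ε).1 x| ≤ C * (ε : ℝ) ^ k

variable {O : EpsI → Opens (Eucl n)} {K : Set (Eucl n)} {v w : Nets O} {k l : ℤ}

lemma IsBigOOn.add (hv : IsBigOOn K v k) (hw : IsBigOOn K w k) : IsBigOOn K (v + w) k := by
  obtain ⟨C, hC⟩ := hv
  obtain ⟨C', hC'⟩ := hw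
  refine ⟨C + C', ?_⟩
  filter_upwards [hC, hC'] with ε h h' x hx
  rw [add_mul]
  exact (abs_add_le _ _).trans (add_le_add (h x hx) (h' x hx))

lemma IsBigOOn.mul (hv : IsBigOOn K v k) (hw : IsBigOOn K w l) :
    IsBigOOn K (v * w) (k + l) := by
  obtain ⟨C, hC⟩ := hv
  obtain ⟨C', hC'⟩ := hw
  refine ⟨C * C', ?_⟩
  filter_upwards [hC, hC'] with ε h h' x hx
  rw [zpow_add₀ ε.2.1.ne', mul_mul_mul_comm]
  exact (abs_mul _ _).trans_le
    (mul_le_mul (h x hx) (h' x hx) (abs_nonneg _) ((abs_nonneg _).trans (h x hx)))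

lemma IsBigOOn.mono (hv : IsBigOOn K v k) (hl : l ≤ k) : IsBigOOn K v l := by
  obtain ⟨C, hC⟩ := hv
  refine ⟨|C|, ?_⟩
  filter_upwards [hC] with ε h x hx
  refine (h x hx).trans (mul_le_mul (le_abs_self C) ?_ (zpow_nonneg ε.2.1.le _) (abs_nonneg _))
  exact zpow_le_zpow_right_of_le_one₀ ε.2.1 ε.2.2 hl

lemma isBigOOn_const (r : ℝ) : IsBigOOn K (algebraMap ℝ (Nets O) r) 0 :=
  ⟨|r|, Eventually.of_forall fun ε x _ ↦ by
    rw [zpow_zero, mul_one]; exact le_rfl⟩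

lemma isBigOOn_zero (k : ℤ) : IsBigOOn K (0 : Nets O) k :=
  ⟨0, Eventually.of_forall fun ε x _ ↦ by simp⟩

end Asymptotics

/-- A linear endomorphism of an algebra that preserves an ideal, on the quotient. -/
def quotientMap {M : Type*} [CommRing M] [Algebra ℝ M] (I : Ideal M) (D : Module.End ℝ M)
    (h : ∀ u ∈ I, D u ∈ I) : Module.End ℝ (M ⧸ I) :=
  ((Submodule.Quotient.restrictScalarsEquiv ℝ I).toLinearMap ∘ₗ
    Submodule.mapQ (I.restrictScalars ℝ) (I.restrictScalars ℝ) D h) ∘ₗ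
    (Submodule.Quotient.restrictScalarsEquiv ℝ I).symm.toLinearMap

lemma quotientMap_mk {M : Type*} [CommRing M] [Algebra ℝ M] (I : Ideal M) (D : Module.End ℝ M)
    (h : ∀ u ∈ I, D u ∈ I) (u : M) :
    quotientMap I D h (Ideal.Quotient.mk I u) = Ideal.Quotient.mk I (D u) := rfl

/-- The ideals of a commutative ring. (This fixes the path of type class instances.) -/
abbrev IdealOf (R : Type*) [CommRing R] := Ideal R

/-! ### The special Colombeau algebra -/

section Special

variable {n : ℕ} (Ω : Opens (Eucl n))

/-- The algebra `C^∞(Ω)^I` of nets of smooth functions. -/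
abbrev SNets := Nets (fun _ : EpsI ↦ Ω)

variable {Ω} in
/-- Moderate nets. -/
def IsModerateS (u : SNets Ω) : Prop :=
  ∀ K : Set (Eucl n), IsCompact K → K ⊆ Ω → ∀ α : Fin n → ℕ,
    ∃ N : ℕ, IsBigOOn K (netDeriv α u) (-(N : ℤ))

variable {Ω} in
/-- Negligible nets. -/
def IsNegligibleS (u : SNets Ω) : Prop :=
  ∀ K : Set (Eucl n), IsCompact K → K ⊆ Ω → ∀ α : Fin n → ℕ,
    ∀ m : ℕ, IsBigOOn K (netDeriv α u) (m : ℤ)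

/-- The algebra `𝓔ˢ_M(Ω)` of moderate nets. -/
def ModS : Subalgebra ℝ (SNets Ω) where
  carrier := {u | IsModerateS u}
  mul_mem' {u v} hu hv K hK hKΩ :=
    forall_netDeriv_mul (P := fun w ↦ ∃ N : ℕ, IsBigOOn K w (-(N : ℤ)))
      (Q := fun w ↦ ∃ N : ℕ, IsBigOOn K w (-(N : ℤ)))
      (R := fun w ↦ ∃ N : ℕ, IsBigOOn K w (-(N : ℤ)))
      (fun a b ⟨N, ha⟩ ⟨N', hb⟩ ↦ ⟨N + N', (ha.mono (by push_cast; omega)).add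
        (hb.mono (by push_cast; omega))⟩)
      (fun a b ⟨N, ha⟩ ⟨N', hb⟩ ↦ ⟨N + N', (ha.mul hb).mono (by push_cast; omega)⟩)
      (hu K hK hKΩ) (hv K hK hKΩ)
  add_mem' {u v} hu hv K hK hKΩ :=
    forall_netDeriv_add (P := fun w ↦ ∃ N : ℕ, IsBigOOn K w (-(N : ℤ)))
      (fun a b ⟨N, ha⟩ ⟨N', hb⟩ ↦ ⟨N + N', (ha.mono (by push_cast; omega)).add
        (hb.mono (by push_cast; omega))⟩) (hu K hK hKΩ) (hv K hK hKΩ)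
  algebraMap_mem' r K hK hKΩ :=
    forall_netDeriv_algebraMap (P := fun w ↦ ∃ N : ℕ, IsBigOOn K w (-(N : ℤ)))
      (fun r ↦ ⟨0, by simpa using isBigOOn_const r⟩) r

/-- The ideal `𝓝ˢ(Ω)` of negligible nets in the algebra of moderate nets. -/
def NegS : IdealOf (ModS Ω) where
  carrier := {u | IsNegligibleS u.1}
  add_mem' {u v} hu hv K hK hKΩ :=
    forall_netDeriv_add (P := fun w ↦ ∀ m : ℕ, IsBigOOn K w (m : ℤ))
      (fun a b ha hb m ↦ (ha m).add (hb m)) (hu K hK hKΩ) (hv K hK hKΩ)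
  zero_mem' K hK hKΩ α m := by
    rw [netDeriv_eq]
    simpa using isBigOOn_zero (m : ℤ)
  smul_mem' c u hu K hK hKΩ :=
    forall_netDeriv_mul (P := fun w ↦ ∃ N : ℕ, IsBigOOn K w (-(N : ℤ)))
      (Q := fun w ↦ ∀ m : ℕ, IsBigOOn K w (m : ℤ))
      (R := fun w ↦ ∀ m : ℕ, IsBigOOn K w (m : ℤ))
      (fun a b ha hb m ↦ (ha m).add (hb m))
      (fun a b ⟨N, ha⟩ hb m ↦ (ha.mul (hb (N + m))).mono (by push_cast; omega))
      (c.2 K hK hKΩ) (hu K hK hKΩ)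

/-- The derivative `∂^α` on moderate nets. -/
def ModS.deriv (α : Fin n → ℕ) : Module.End ℝ (ModS Ω) where
  toFun u := ⟨netDeriv α u.1, fun K hK hKΩ ↦
    forall_netDeriv_netDeriv (P := fun w ↦ ∃ N : ℕ, IsBigOOn K w (-(N : ℤ)))
      (u.2 K hK hKΩ) α⟩
  map_add' u v := Subtype.ext (netDeriv_add α u.1 v.1)
  map_smul' c u := Subtype.ext (by simp [netDeriv_eq])

/-- The special Colombeau algebra `𝓖ˢ(Ω) = 𝓔ˢ_M(Ω) / 𝓝ˢ(Ω)`. -/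
def GSpecial : Type := ModS Ω ⧸ NegS Ω

instance : CommRing (GSpecial Ω) := inferInstanceAs (CommRing (ModS Ω ⧸ NegS Ω))

instance : Algebra ℝ (GSpecial Ω) := inferInstanceAs (Algebra ℝ (ModS Ω ⧸ NegS Ω))

/-- The class `[u_ε]` of a moderate net. -/
def GSpecial.mk : ModS Ω →ₐ[ℝ] GSpecial Ω := Ideal.Quotient.mkₐ ℝ (NegS Ω)

/-- The derivative `∂^α [u_ε] = [∂^α u_ε]` on `𝓖ˢ(Ω)`. -/
def GSpecial.deriv (α : Fin n → ℕ) : Module.End ℝ (GSpecial Ω) :=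
  quotientMap (NegS Ω) (ModS.deriv Ω α) fun _ hu K hK hKΩ ↦
    forall_netDeriv_netDeriv (P := fun w ↦ ∀ m : ℕ, IsBigOOn K w (m : ℤ)) (hu K hK hKΩ) α

/-- `𝓔ˢ_M(Ω)` carries the sub-diffeology of the power `C^∞(Ω)^I`. -/
instance : DiffeologicalSpace (ModS Ω) :=
  inducedDiffeology Subtype.val (piDiffeology fun _ : EpsI ↦ SmoothFn Ω)

/-- `𝓖ˢ(Ω)` carries the quotient diffeology. -/
instance : DiffeologicalSpace (GSpecial Ω) :=
  quotientDiffeology (GSpecial.mk Ω) (Ideal.Quotient.mkₐ_surjective ℝ (NegS Ω))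

end Special

/-! ### Test functions and distributions -/

section Distributions

variable {n : ℕ}

/-- `𝓓(Ω)` carries the canonical diffeology of a topological vector space. -/
instance (Ω : Opens (Eucl n)) : DiffeologicalSpace 𝓓(Ω, ℝ) := canonicalDiffeology _

/-- Distributions are diffeologically smooth functions on `𝓓(Ω)`. -/
lemma dSmooth_distribution {Ω : Opens (Eucl n)} (u : 𝓓'(Ω, ℝ)) :
    DSmooth (fun χ : 𝓓(Ω, ℝ) ↦ u χ) := fun _ _ hp ↦
  ContDiff.isPlot (hp (⟨u.toLinearMap, u.cont⟩ : 𝓓(Ω, ℝ) →L[ℝ] ℝ))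

/-- `𝓓'(Ω)` carries the sub-diffeology of `C^∞(𝓓(Ω), ℝ)`. -/
instance (Ω : Opens (Eucl n)) : DiffeologicalSpace 𝓓'(Ω, ℝ) :=
  inducedDiffeology
    (fun u ↦ (⟨fun χ ↦ u χ, dSmooth_distribution u⟩ : DMap 𝓓(Ω, ℝ) ℝ)) inferInstance

/-- The space `𝓓(ℝⁿ)`. -/
abbrev DR (n : ℕ) : Type := 𝓓((⊤ : Opens (Eucl n)), ℝ)

/-- The scaled test function `ε ⊙ φ : x ↦ ε⁻ⁿ φ(x / ε)`. -/
def scale (ε : EpsI) (φ : DR n) : DR n where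
  toFun x := ((ε : ℝ) ^ n)⁻¹ * φ ((ε : ℝ)⁻¹ • x)
  contDiff' := contDiff_const.mul (φ.contDiff.comp (contDiff_const_smul _))
  hasCompactSupport' :=
    (φ.hasCompactSupport.comp_homeomorph
      (Homeomorph.smulOfNeZero _ (inv_ne_zero ε.2.1.ne'))).mul_left
  tsupport_subset' := fun _ _ ↦ trivial

/-- A test function on `ℝⁿ` as a smooth function. -/
def DR.toSmooth (φ : DR n) : SmoothFn (⊤ : Opens (Eucl n)) :=
  ⟨fun x ↦ φ x, φ.contDiff.contDiffOn.congr fun x _ ↦ ext_of_mem _ (Opens.mem_top x)⟩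

/-- The moment `∫ x^α φ(x) dx`. -/
def moment (α : Fin n → ℕ) (φ : DR n) : ℝ := ∫ x : Eucl n, (∏ i, x i ^ α i) * φ x

/-- The set `𝓐₀ = 𝓐₀(ℝⁿ)` of test functions with integral one. -/
def A0 (n : ℕ) : Type := {φ : DR n // ∫ x, φ x = 1}

/-- The set `𝓐_q` of those elements of `𝓐₀` whose moments of order `1, …, q` vanish. -/
def Aq (n q : ℕ) : Set (A0 n) :=
  {φ | ∀ α : Fin n → ℕ, 1 ≤ ∑ i, α i → ∑ i, α i ≤ q → moment α φ.1 = 0}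

lemma Aq_antitone (n : ℕ) : Antitone (Aq n) := fun _ _ h _ hφ α h1 hq ↦ hφ α h1 (hq.trans h)

/-- The scaling `φ ↦ ε ⊙ φ` on `𝓐₀`. -/
def A0.scale (ε : EpsI) (φ : A0 n) : A0 n := ⟨Colombeau.scale ε φ.1, by
  have h : ∫ x : Eucl n, ((ε : ℝ) ^ n)⁻¹ * φ.1 ((ε : ℝ)⁻¹ • x) = 1 := by
    rw [integral_const_mul, Measure.integral_comp_inv_smul_of_nonneg volume _ ε.2.1.le, φ.2]
    simp [ε.2.1.ne']
  exact h⟩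

end Distributions

/-! ### The full Colombeau algebra -/

section Full

variable {n : ℕ} (Ω : Opens (Eucl n))

/-- The open set `Ω_φ = Ω ∩ {x | supp φ ⊆ Ω - x}`. -/
def dom (φ : A0 n) : Opens (Eucl n) where
  carrier := {x | x ∈ Ω ∧ ∀ y ∈ tsupport φ.1, y + x ∈ Ω}
  is_open' := by
    refine Ω.isOpen.inter (isOpen_iff_eventually.mpr fun x hx ↦ ?_)
    refine φ.1.hasCompactSupport.isCompact.eventually_forall_of_forall_eventually fun y hy ↦ ?_
    exact (continuous_snd.add continuous_fst).continuousAt.eventually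
      (Ω.isOpen.mem_nhds (hx y hy))

lemma dom_le (φ : A0 n) : dom Ω φ ≤ Ω := fun _ hx ↦ hx.1

/-- The set `U(Ω)` of the pairs `(φ, x)` in `𝓐₀ × Ω` with `supp φ ⊆ Ω - x`. -/
def UDom : Type := {z : A0 n × Eucl n // z.2 ∈ dom Ω z.1}

/-- `U(Ω)` carries the sub-diffeology of `𝓐₀ × ℝⁿ`, where `𝓐₀` has the discrete diffeology. -/
instance : DiffeologicalSpace (UDom Ω) :=
  inducedDiffeology Subtype.val (@prodDiffeology _ _ (discreteDiffeology (A0 n)) inferInstance)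

/-- The algebra `𝓔ᵉ(Ω)` of the functions `R : U(Ω) → ℝ` such that `R(φ, -)` is smooth on `Ω_φ` for
all `φ ∈ 𝓐₀`, in curried form `φ ↦ R(φ, -)`. -/
abbrev ENets := Nets (dom Ω)

variable {Ω} in
/-- The function `(φ, x) ↦ R(φ, x)` on `U(Ω)`. -/
def ENets.toFun (R : ENets Ω) (z : UDom Ω) : ℝ := (R z.1.1).1 ⟨z.1.2, z.2⟩

lemma ENets.dSmooth (R : ENets Ω) : DSmooth (ENets.toFun R) := fun k q hq ↦ by
  have h1 : IsLocallyConstant fun t ↦ (q t).1.1 := hq.1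
  have h2 : ContDiff ℝ ∞ fun t ↦ (q t).1.2 := IsPlot.contDiff hq.2
  refine ContDiff.isPlot (contDiff_iff_contDiffAt.mpr fun t ↦ ?_)
  have h3 := (contDiffAt_ext (R (q t).1.1) (q t).2).comp t h2.contDiffAt
  refine h3.congr_of_eventuallyEq ?_
  filter_upwards [h1.eventually_eq t] with s hs
  have hm : (q s).1.2 ∈ dom Ω (q t).1.1 := hs ▸ (q s).2
  have key : ∀ φ (hφ : (q s).1.2 ∈ dom Ω φ), (q s).1.1 = φ →
      (R (q s).1.1).1 ⟨(q s).1.2, (q s).2⟩ = (R φ).1 ⟨(q s).1.2, hφ⟩ := by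
    rintro φ hφ rfl; rfl
  exact (key _ hm hs).trans (ext_of_mem _ hm).symm

/-- `𝓔ᵉ(Ω)` carries the sub-diffeology of `C^∞(U(Ω), ℝ)`. -/
@[reducible] def diffeologyENets : DiffeologicalSpace (ENets Ω) :=
  inducedDiffeology (fun R ↦ (⟨R.toFun, ENets.dSmooth Ω R⟩ : DMap (UDom Ω) ℝ)) inferInstance

variable {Ω} in
/-- The net `ε ↦ R(ε ⊙ φ, -)`. -/
def ENets.along (R : ENets Ω) (φ : A0 n) : Nets (fun ε : EpsI ↦ dom Ω (φ.scale ε)) :=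
  fun ε ↦ R (φ.scale ε)

variable {Ω} in
/-- Moderate elements of `𝓔ᵉ(Ω)`. -/
def IsModerateE (R : ENets Ω) : Prop :=
  ∀ K : Set (Eucl n), IsCompact K → K ⊆ Ω → ∀ α : Fin n → ℕ,
    ∃ N : ℕ, ∀ φ ∈ Aq n N, IsBigOOn K (ENets.along (netDeriv α R) φ) (-(N : ℤ))

variable {Ω} in
/-- Negligible elements of `𝓔ᵉ(Ω)`. -/
def IsNegligibleE (R : ENets Ω) : Prop :=
  ∀ K : Set (Eucl n), IsCompact K → K ⊆ Ω → ∀ α : Fin n → ℕ,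
    ∀ m : ℕ, ∃ q : ℕ, ∀ φ ∈ Aq n q, IsBigOOn K (ENets.along (netDeriv α R) φ) (m : ℤ)

/-- The algebra `𝓔ᵉ_M(Ω)` of moderate elements. -/
def ModE : Subalgebra ℝ (ENets Ω) where
  carrier := {u | IsModerateE u}
  mul_mem' {u v} hu hv K hK hKΩ :=
    forall_netDeriv_mul
      (P := fun w ↦ ∃ N : ℕ, ∀ φ ∈ Aq n N, IsBigOOn K (ENets.along w φ) (-(N : ℤ)))
      (Q := fun w ↦ ∃ N : ℕ, ∀ φ ∈ Aq n N, IsBigOOn K (ENets.along w φ) (-(N : ℤ)))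
      (R := fun w ↦ ∃ N : ℕ, ∀ φ ∈ Aq n N, IsBigOOn K (ENets.along w φ) (-(N : ℤ)))
      (fun a b ⟨N, ha⟩ ⟨N', hb⟩ ↦ ⟨N + N', fun φ hφ ↦
        ((ha φ (Aq_antitone n (by omega) hφ)).mono (by push_cast; omega)).add
        ((hb φ (Aq_antitone n (by omega) hφ)).mono (by push_cast; omega))⟩)
      (fun a b ⟨N, ha⟩ ⟨N', hb⟩ ↦ ⟨N + N', fun φ hφ ↦
        ((ha φ (Aq_antitone n (by omega) hφ)).mul
        (hb φ (Aq_antitone n (by omega) hφ))).mono (by push_cast; omega)⟩)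
      (hu K hK hKΩ) (hv K hK hKΩ)
  add_mem' {u v} hu hv K hK hKΩ :=
    forall_netDeriv_add
      (P := fun w ↦ ∃ N : ℕ, ∀ φ ∈ Aq n N, IsBigOOn K (ENets.along w φ) (-(N : ℤ)))
      (fun a b ⟨N, ha⟩ ⟨N', hb⟩ ↦ ⟨N + N', fun φ hφ ↦
        ((ha φ (Aq_antitone n (by omega) hφ)).mono (by push_cast; omega)).add
        ((hb φ (Aq_antitone n (by omega) hφ)).mono (by push_cast; omega))⟩)
      (hu K hK hKΩ) (hv K hK hKΩ)
  algebraMap_mem' r K hK hKΩ :=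
    forall_netDeriv_algebraMap
      (P := fun w ↦ ∃ N : ℕ, ∀ φ ∈ Aq n N, IsBigOOn K (ENets.along w φ) (-(N : ℤ)))
      (fun r ↦ ⟨0, fun φ _ ↦ by
        have h : IsBigOOn K (ENets.along (algebraMap ℝ (ENets Ω) r) φ) 0 := isBigOOn_const r
        simpa using h⟩) r

/-- The ideal `𝓝ᵉ(Ω)` of negligible elements in the algebra of moderate elements. -/
def NegE : IdealOf (ModE Ω) where
  carrier := {u | IsNegligibleE u.1}
  add_mem' {u v} hu hv K hK hKΩ :=
    forall_netDeriv_add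
      (P := fun w ↦ ∀ m : ℕ, ∃ q : ℕ, ∀ φ ∈ Aq n q, IsBigOOn K (ENets.along w φ) (m : ℤ))
      (fun a b ha hb m ↦ by
        obtain ⟨q, hq⟩ := ha m
        obtain ⟨q', hq'⟩ := hb m
        exact ⟨q + q', fun φ hφ ↦ (hq φ (Aq_antitone n (by omega) hφ)).add
          (hq' φ (Aq_antitone n (by omega) hφ))⟩)
      (hu K hK hKΩ) (hv K hK hKΩ)
  zero_mem' K hK hKΩ α m := by
    refine ⟨0, fun φ _ ↦ ?_⟩
    have h : IsBigOOn K (ENets.along (0 : ENets Ω) φ) (m : ℤ) := isBigOOn_zero _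
    rw [netDeriv_eq]
    simpa using h
  smul_mem' c u hu K hK hKΩ :=
    forall_netDeriv_mul
      (P := fun w ↦ ∃ N : ℕ, ∀ φ ∈ Aq n N, IsBigOOn K (ENets.along w φ) (-(N : ℤ)))
      (Q := fun w ↦ ∀ m : ℕ, ∃ q : ℕ, ∀ φ ∈ Aq n q, IsBigOOn K (ENets.along w φ) (m : ℤ))
      (R := fun w ↦ ∀ m : ℕ, ∃ q : ℕ, ∀ φ ∈ Aq n q, IsBigOOn K (ENets.along w φ) (m : ℤ))
      (fun a b ha hb m ↦ by
        obtain ⟨q, hq⟩ := ha m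
        obtain ⟨q', hq'⟩ := hb m
        exact ⟨q + q', fun φ hφ ↦ (hq φ (Aq_antitone n (by omega) hφ)).add
          (hq' φ (Aq_antitone n (by omega) hφ))⟩)
      (fun a b ⟨N, ha⟩ hb m ↦ by
        obtain ⟨q, hq⟩ := hb (N + m)
        exact ⟨N + q, fun φ hφ ↦ ((ha φ (Aq_antitone n (by omega) hφ)).mul
          (hq φ (Aq_antitone n (by omega) hφ))).mono (by push_cast; omega)⟩)
      (c.2 K hK hKΩ) (hu K hK hKΩ)

/-- The derivative `∂^α` (in the variable `x`) on moderate elements. -/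
def ModE.deriv (α : Fin n → ℕ) : Module.End ℝ (ModE Ω) where
  toFun u := ⟨netDeriv α u.1, fun K hK hKΩ ↦
    forall_netDeriv_netDeriv
      (P := fun w ↦ ∃ N : ℕ, ∀ φ ∈ Aq n N, IsBigOOn K (ENets.along w φ) (-(N : ℤ)))
      (u.2 K hK hKΩ) α⟩
  map_add' u v := Subtype.ext (netDeriv_add α u.1 v.1)
  map_smul' c u := Subtype.ext (by simp [netDeriv_eq])

/-- The full Colombeau algebra `𝓖ᵉ(Ω) = 𝓔ᵉ_M(Ω) / 𝓝ᵉ(Ω)`. -/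
def GFull : Type := ModE Ω ⧸ NegE Ω

instance : CommRing (GFull Ω) := inferInstanceAs (CommRing (ModE Ω ⧸ NegE Ω))

instance : Algebra ℝ (GFull Ω) := inferInstanceAs (Algebra ℝ (ModE Ω ⧸ NegE Ω))

/-- The class `[R]` of a moderate element. -/
def GFull.mk : ModE Ω →ₐ[ℝ] GFull Ω := Ideal.Quotient.mkₐ ℝ (NegE Ω)

/-- The derivative `∂^α [R] = [∂^α R]` on `𝓖ᵉ(Ω)`. -/
def GFull.deriv (α : Fin n → ℕ) : Module.End ℝ (GFull Ω) :=
  quotientMap (NegE Ω) (ModE.deriv Ω α) fun _ hu K hK hKΩ ↦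
    forall_netDeriv_netDeriv
      (P := fun w ↦ ∀ m : ℕ, ∃ q : ℕ, ∀ φ ∈ Aq n q, IsBigOOn K (ENets.along w φ) (m : ℤ))
      (hu K hK hKΩ) α

/-- `𝓔ᵉ_M(Ω)` carries the sub-diffeology of `𝓔ᵉ(Ω)`. -/
instance : DiffeologicalSpace (ModE Ω) := inducedDiffeology Subtype.val (diffeologyENets Ω)

/-- `𝓖ᵉ(Ω)` carries the quotient diffeology. -/
instance : DiffeologicalSpace (GFull Ω) :=
  quotientDiffeology (GFull.mk Ω) (Ideal.Quotient.mkₐ_surjective ℝ (NegE Ω))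

end Full

/-! ### The embeddings -/

section Embeddings

variable {n : ℕ} {Ω : Opens (Eucl n)}

lemma exists_bound (f : SmoothFn Ω) {K : Set (Eucl n)} (hK : IsCompact K) (hKΩ : K ⊆ Ω) :
    ∃ C, ∀ x : Ω, (x : Eucl n) ∈ K → |f.1 x| ≤ C := by
  obtain ⟨C, hC⟩ := hK.exists_bound_of_continuousOn (f.2.continuousOn.mono hKΩ)
  refine ⟨C, fun x hx ↦ ?_⟩
  have := hC x hx
  rwa [ext_of_mem _ x.2] at this

lemma netDeriv_restrict {J : Type*} {O : J → Opens (Eucl n)} (h : ∀ j, O j ≤ Ω)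
    (α : Fin n → ℕ) (f : SmoothFn Ω) :
    netDeriv α (fun j ↦ restrictFn (h j) f : Nets O) = fun j ↦ restrictFn (h j) (mderiv α f) := by
  have key : ∀ l : List (Fin n), wordDeriv l (fun j ↦ restrictFn (h j) f : Nets O)
      = fun j ↦ restrictFn (h j) ((wordDeriv l (fun _ : Unit ↦ f)) ()) := fun l ↦ by
    induction l with
    | nil => rfl
    | cons i l ih =>
      funext j
      have := congrFun ih j
      simp only [wordDeriv, LinearMap.coe_mk, AddHom.coe_mk, List.map_cons, List.prod_cons,
        Module.End.mul_apply] at this ⊢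
      rw [this, pderiv_restrict]
  rw [netDeriv_eq, key]
  funext j
  rw [← netDeriv_eq]; rfl

/-- The embedding `σ_Ω(f) = [f]` of `C^∞(Ω)` into `𝓖ˢ(Ω)` by constant nets. -/
def sigmaSpecial (f : SmoothFn Ω) : GSpecial Ω :=
  GSpecial.mk Ω ⟨fun _ ↦ f, fun K hK hKΩ α ↦ by
    obtain ⟨C, hC⟩ := exists_bound (mderiv α f) hK hKΩ
    exact ⟨0, C, Eventually.of_forall fun ε x hx ↦ by
      rw [Nat.cast_zero, neg_zero, zpow_zero, mul_one]; exact hC x hx⟩⟩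

/-- The embedding `σ_Ω(f) = [(φ, x) ↦ f(x)]` of `C^∞(Ω)` into `𝓖ᵉ(Ω)`. -/
def sigmaFull (f : SmoothFn Ω) : GFull Ω :=
  GFull.mk Ω ⟨fun φ ↦ restrictFn (dom_le Ω φ) f, fun K hK hKΩ α ↦ by
    obtain ⟨C, hC⟩ := exists_bound (mderiv α f) hK hKΩ
    refine ⟨0, fun φ _ ↦ ⟨C, Eventually.of_forall fun ε x hx ↦ ?_⟩⟩
    rw [netDeriv_restrict, Nat.cast_zero, neg_zero, zpow_zero, mul_one]
    exact hC ⟨x, dom_le Ω _ x.2⟩ hx⟩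

/-- The properties of the nets `ψ_ε` of mollifiers used to embed the distributions into the
special algebra. -/
structure IsMollifierNet (ψ : EpsI → DR n) : Prop where
  supp : ∀ ε, ∀ x ∈ tsupport (ψ ε), ‖x‖ < 1
  integral_eq_one : ∀ ε, ∫ x, ψ ε x = 1
  moderate : ∀ α : Fin n → ℕ, ∃ N : ℕ,
    IsBigOOn univ (netDeriv α fun ε ↦ (ψ ε).toSmooth) (-(N : ℤ))
  moments : ∀ j : ℕ, ∀ᶠ ε in zeroI, ∀ α : Fin n → ℕ,
    1 ≤ ∑ i, α i → ∑ i, α i ≤ j → moment α (ψ ε) = 0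
  integral_abs : ∀ η : ℝ, 0 < η → ∀ᶠ ε in zeroI, ∫ x, |ψ ε x| ≤ 1 + η

/-- `g = [u * (ε ⊙ ψ_ε)|_Ω]` in `𝓖ˢ(Ω)`: the class `g` has a representative `v` such that on every
compact subset of `Ω`, for all small `ε`, the value `v_ε(x)` is the pairing of `u` with
`y ↦ (ε ⊙ ψ_ε)(x - y)`, which is a test function on `Ω` for such `x` and `ε`. -/
def IsIotaSpecial (ψ : EpsI → DR n) (u : 𝓓'(Ω, ℝ)) (g : GSpecial Ω) : Prop :=
  ∃ v : ModS Ω, GSpecial.mk Ω v = g ∧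
    ∀ K : Set (Eucl n), IsCompact K → K ⊆ Ω → ∀ᶠ ε in zeroI, ∀ x : Ω, (x : Eucl n) ∈ K →
      ∃ χ : 𝓓(Ω, ℝ), (∀ y, χ y = scale ε (ψ ε) (x - y)) ∧ (v.1 ε).1 x = u χ

/-- `g` is the class in `𝓖ᵉ(Ω)` of `R(φ, x) = ⟨u, φ(· - x)⟩`. -/
def IsIotaFull (u : 𝓓'(Ω, ℝ)) (g : GFull Ω) : Prop :=
  ∃ R : ModE Ω, GFull.mk Ω R = g ∧ ∀ (φ : A0 n) (x : dom Ω φ),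
    ∃ χ : 𝓓(Ω, ℝ), (∀ y, χ y = φ.1 (y - x)) ∧ (R.1 φ).1 x = u χ

end Embeddings

end Colombeau
end

noncomputable section

namespace Colombeau

/-! ### Plots in spaces of smooth functions -/

section Plots

variable {n k : ℕ} {O : Opens (Eucl n)}

/-! Growth in ε plays no part in the diffeologies. A plot of `ModS Ω` is a family whose member at
each ε is jointly smooth in parameter and variable; since 𝓐₀ is discrete, a plot of `ModE Ω` is the
same for each φ (`isPlot_modE_iff`). Sums, products and derivatives of jointly smooth functions are
jointly smooth, and plots of the quotients lift locally, so the operations and both embeddings of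
smooth functions are smooth.

Smoothness of a binary operation does not by itself make it continuous for the product of the
D-topologies. Instead the D-topologies are computed. Because plots need no uniformity in ε, a plot
can pass from u to v in such a way that at every parameter t ≠ 0 the net already equals v for small
ε (`joinNet`). Hence the D-topology of 𝓖ˢ is indiscrete, and so is that of 𝓖ᵉ when n ≥ 1, where the
growing sup norm of ε ⊙ φ takes the place of 1/ε. For n = 0 the set 𝓐₀ has at most one element, and
𝓖ᵉ is either trivial or identified with ℝ by smooth maps in both directions (`GFull.exists_eval`).

For distributions the central object is x ↦ ⟨L, φ(· - x)⟩. The first order Taylor remainder of φ is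
quadratically small with all derivatives, so the continuity of L yields the derivative
(`hasFDerivAt_pair`), and induction yields smoothness. Thus x ↦ φ(· - x) is a plot of 𝓓(Ω), and the
functional diffeology on 𝓓'(Ω) gives joint smoothness in the distribution and x (`isPlot_pairFn`).
Moderateness follows from the finite order of L over a compact set and the scaling of derivatives.
In the special algebra a cut-off independent of u extends the regularization to Ω; representatives
that agree on each compact set for small ε have the same class. -/

/-- A map into `C^∞(O)` is a plot iff it is jointly smooth in the parameter and the variable. -/
lemma isPlot_smoothFn_iff (p : Eucl k → SmoothFn O) :
    IsPlot p ↔ ContDiffOn ℝ ∞ (fun z : Eucl k × Eucl n ↦ ext (p z.1).1 z.2)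
      {z | z.2 ∈ O} := by
  constructor
  · rintro hp ⟨t₀, x₀⟩ (hx₀ : x₀ ∈ O)
    -- Plots are defined on a whole Euclidean space. So joint smoothness near (t₀, x₀) is tested on
    -- (t, x) ↦ (t, r x), with r valued in O and the identity near x₀; `toEuclidean` supplies the
    -- model of the product.
    obtain ⟨r, hr, hrO, hrx⟩ := exists_smooth_retraction O.isOpen hx₀
    let e := toEuclidean (E := Eucl k × Eucl n)
    have h1 : ContDiff ℝ ∞ fun s ↦ (e.symm s).1 := contDiff_fst.comp e.symm.contDiff
    have h2 : ContDiff ℝ ∞ fun s ↦ r (e.symm s).2 :=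
      hr.comp (contDiff_snd.comp e.symm.contDiff)
    have h : ContDiff ℝ ∞ fun s ↦ (p (e.symm s).1).1 ⟨r (e.symm s).2, hrO _⟩ :=
      IsPlot.contDiff (hp _ (fun s ↦ ((e.symm s).1, (⟨r (e.symm s).2, hrO _⟩ : O)))
        ⟨h1.isPlot, h2.isPlot⟩)
    have h' := (h.comp e.contDiff).contDiffAt (x := (t₀, x₀))
    refine (h'.congr_of_eventuallyEq ?_).contDiffWithinAt
    have := (continuous_snd.tendsto (t₀, x₀)).eventually hrx
    filter_upwards [this] with z hz
    have hzO : z.2 ∈ O := hz ▸ hrO z.2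
    simp only [Function.comp_apply, ContinuousLinearEquiv.symm_apply_apply, hz]
    exact ext_of_mem _ hzO
  · intro hp m q hq
    have h1 : ContDiff ℝ ∞ fun s ↦ (q s).1 := IsPlot.contDiff hq.1
    have h2 : ContDiff ℝ ∞ fun s ↦ ((q s).2 : Eucl n) := IsPlot.contDiff hq.2
    refine ContDiff.isPlot ?_
    have := hp.comp_contDiff (h1.prodMk h2) fun s ↦ (q s).2.2
    have e : (fun z : Eucl k × O ↦ (p z.1).1 z.2) ∘ q
        = (fun z ↦ ext (p z.1).1 z.2) ∘ fun s ↦ ((q s).1, ((q s).2 : Eucl n)) :=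
      funext fun s ↦ (ext_of_mem _ (q s).2.2).symm
    exact e ▸ this

lemma isPlot_smoothFn_add {p q : Eucl k → SmoothFn O} (hp : IsPlot p) (hq : IsPlot q) :
    IsPlot (fun t ↦ p t + q t) := by
  rw [isPlot_smoothFn_iff] at hp hq ⊢
  exact (hp.add hq).congr fun z hz ↦ by simp [ext_of_mem _ (show z.2 ∈ O from hz)]

lemma isPlot_smoothFn_mul {p q : Eucl k → SmoothFn O} (hp : IsPlot p) (hq : IsPlot q) :
    IsPlot (fun t ↦ p t * q t) := by
  rw [isPlot_smoothFn_iff] at hp hq ⊢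
  exact (hp.mul hq).congr fun z hz ↦ by simp [ext_of_mem _ (show z.2 ∈ O from hz)]

lemma isPlot_smoothFn_smul {c : Eucl k → ℝ} {p : Eucl k → SmoothFn O} (hc : ContDiff ℝ ∞ c)
    (hp : IsPlot p) : IsPlot (fun t ↦ c t • p t) := by
  rw [isPlot_smoothFn_iff] at hp ⊢
  exact ((hc.comp contDiff_fst).contDiffOn.mul hp).congr fun z hz ↦ by
    simp [ext_of_mem _ (show z.2 ∈ O from hz)]

/-- The derivative in x alone is the total derivative of the joint map in the direction (0, eᵢ), and
this is again jointly smooth. -/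
lemma dSmooth_pderiv (i : Fin n) : DSmooth (pderiv i : Module.End ℝ (SmoothFn O)) := by
  intro k p hp
  rw [isPlot_smoothFn_iff] at hp ⊢
  have ho : IsOpen {z : Eucl k × Eucl n | z.2 ∈ O} := O.isOpen.preimage continuous_snd
  have h := (hp.fderiv_of_isOpen ho (m := ∞) (by simp)).clm_apply
    (contDiffOn_const (c := ((0 : Eucl k), EuclideanSpace.single i (1 : ℝ))))
  refine h.congr fun z hz ↦ ?_
  have hzO : z.2 ∈ O := hz
  rw [ext_of_mem _ hzO]
  change fderiv ℝ (ext (p z.1).1) z.2 _ = _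
  have hd : HasFDerivAt (fun z : Eucl k × Eucl n ↦ ext (p z.1).1 z.2)
      (fderiv ℝ (fun z : Eucl k × Eucl n ↦ ext (p z.1).1 z.2) z) (z.1, z.2) :=
    ((hp.contDiffAt (ho.mem_nhds hz)).differentiableAt (by simp)).hasFDerivAt
  have := hd.comp z.2 ((hasFDerivAt_const z.1 z.2).prodMk (hasFDerivAt_id z.2))
  have h2 : fderiv ℝ (ext (p z.1).1) z.2 = _ := this.fderiv
  rw [h2]
  simp

lemma dSmooth_mderiv (α : Fin n → ℕ) : DSmooth (mderiv α : Module.End ℝ (SmoothFn O)) := by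
  have hpow (i : Fin n) (m : ℕ) : DSmooth ⇑(pderiv i ^ m : Module.End ℝ (SmoothFn O)) := by
    induction m with
    | zero => exact dSmooth_id
    | succ m ih => rw [pow_succ]; exact ih.comp (dSmooth_pderiv i)
  refine List.prod_induction (fun D : Module.End ℝ (SmoothFn O) ↦ DSmooth D)
    (fun a b ha hb ↦ ha.comp hb) dSmooth_id ?_
  intro D hD
  obtain ⟨i, -, rfl⟩ := List.mem_map.mp hD
  exact hpow i _

lemma isPlot_restrictFn {O' : Opens (Eucl n)} (h : O' ≤ O) {p : Eucl k → SmoothFn O}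
    (hp : IsPlot p) : IsPlot (fun t ↦ restrictFn h (p t)) := by
  rw [isPlot_smoothFn_iff] at hp ⊢
  refine (hp.mono fun z hz ↦ h hz).congr fun z hz ↦ ?_
  rw [ext_of_mem _ (show z.2 ∈ O' from hz), ext_of_mem _ (h hz)]
  rfl

end Plots

/-! ### Plots of nets, member by member -/

section PlotsOfNets

variable {n k : ℕ} {Ω : Opens (Eucl n)}

/-- No uniformity in ε is asked of a plot; this is what makes the D-topology so coarse. -/
lemma isPlot_modS_iff (p : Eucl k → ModS Ω) : IsPlot p ↔ ∀ ε, IsPlot (fun t ↦ (p t).1 ε) :=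
  Iff.rfl

/-- A plot of U(Ω) has a locally constant first component, so smoothness on U(Ω) can be checked with
φ fixed. -/
lemma isPlot_modE_iff (p : Eucl k → ModE Ω) : IsPlot p ↔ ∀ φ, IsPlot (fun t ↦ (p t).1 φ) := by
  constructor
  · intro hp φ m q hq
    exact hp m (fun s ↦ ((q s).1, ⟨(φ, (q s).2), (q s).2.2⟩))
      ⟨hq.1, IsLocallyConstant.const φ, hq.2⟩
  · intro hp m q hq
    have h1 : IsLocallyConstant fun s ↦ (q s).2.1.1 := hq.2.1
    have h2 : ContDiff ℝ ∞ fun s ↦ (q s).2.1.2 := IsPlot.contDiff hq.2.2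
    have h0 : ContDiff ℝ ∞ fun s ↦ (q s).1 := IsPlot.contDiff hq.1
    refine ContDiff.isPlot (contDiff_iff_contDiffAt.mpr fun s ↦ ?_)
    have h3 := (isPlot_smoothFn_iff _).mp (hp (q s).2.1.1)
    have ho : IsOpen {z : Eucl k × Eucl n | z.2 ∈ dom Ω (q s).2.1.1} :=
      (dom Ω (q s).2.1.1).isOpen.preimage continuous_snd
    have h4 := (h3.contDiffAt (x := ((q s).1, (q s).2.1.2)) (ho.mem_nhds (q s).2.2)).comp s
      (h0.prodMk h2).contDiffAt
    refine h4.congr_of_eventuallyEq ?_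
    filter_upwards [h1.eventually_eq s] with r hr
    have hm : (q r).2.1.2 ∈ dom Ω (q s).2.1.1 := hr ▸ (q r).2.2
    -- Generalizing over φ allows substitution, since the domain of the member depends on φ.
    have key : ∀ φ (hφ : (q r).2.1.2 ∈ dom Ω φ), (q r).2.1.1 = φ →
        ((p (q r).1).1 (q r).2.1.1).1 ⟨(q r).2.1.2, (q r).2.2⟩
          = ((p (q r).1).1 φ).1 ⟨(q r).2.1.2, hφ⟩ := by
      rintro φ hφ rfl; rfl
    exact (key _ hm hr).trans (ext_of_mem _ hm).symm

end PlotsOfNets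

/-! ### Smooth maps on quotients -/

section Quotients

variable {M Q : Type*} [DiffeologicalSpace M] {π : M → Q} (hπ : Function.Surjective π)

lemma dSmooth_quotient_mk : @DSmooth M Q _ (quotientDiffeology π hπ) π :=
  (quotientDiffeology_le_iff π hπ _).mp le_rfl

lemma dSmooth_quotient_map {f : M → M} {g : Q → Q} (hf : DSmooth f) (h : ∀ u, g (π u) = π (f u)) :
    @DSmooth Q Q (quotientDiffeology π hπ) (quotientDiffeology π hπ) g := by
  intro k p hp x
  obtain ⟨δ, hδ, h'⟩ := hp x
  refine ⟨f ∘ δ, hf k δ hδ, ?_⟩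
  filter_upwards [h'] with y hy
  simp [hy, h]

/-- The two components lift near the same parameter value, and f is applied to the lifts. -/
lemma dSmooth_quotient_map₂ {f : M → M → M} {g : Q → Q → Q}
    (hf : ∀ (k : ℕ) (p q : Eucl k → M), IsPlot p → IsPlot q → IsPlot (fun t ↦ f (p t) (q t)))
    (h : ∀ u v, g (π u) (π v) = π (f u v)) :
    letI := quotientDiffeology π hπ
    DSmooth (fun p : Q × Q ↦ g p.1 p.2) := by
  intro k p hp x
  obtain ⟨δ, hδ, h'⟩ := hp.1 x
  obtain ⟨δ', hδ', h''⟩ := hp.2 x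
  refine ⟨_, hf k δ δ' hδ hδ', ?_⟩
  filter_upwards [h', h''] with y hy hy'
  simp [hy, hy', h]

end Quotients

/-! ### Smoothness of the operations and of the embeddings of smooth functions -/

section Operations

variable {n : ℕ} (Ω : Opens (Eucl n))

lemma GSpecial.mk_surjective : Function.Surjective (GSpecial.mk Ω) :=
  Ideal.Quotient.mkₐ_surjective ℝ (NegS Ω)

lemma GFull.mk_surjective : Function.Surjective (GFull.mk Ω) :=
  Ideal.Quotient.mkₐ_surjective ℝ (NegE Ω)

lemma GSpecial.dSmooth_add : DSmooth (fun p : GSpecial Ω × GSpecial Ω ↦ p.1 + p.2) :=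
  dSmooth_quotient_map₂ (GSpecial.mk_surjective Ω) (f := (· + ·))
    (fun _ p q hp hq ↦ (isPlot_modS_iff _).mpr fun ε ↦
    isPlot_smoothFn_add ((isPlot_modS_iff p).mp hp ε) ((isPlot_modS_iff q).mp hq ε))
    fun u v ↦ (map_add (GSpecial.mk Ω) u v).symm

lemma GSpecial.dSmooth_mul : DSmooth (fun p : GSpecial Ω × GSpecial Ω ↦ p.1 * p.2) :=
  dSmooth_quotient_map₂ (GSpecial.mk_surjective Ω) (f := (· * ·))
    (fun _ p q hp hq ↦ (isPlot_modS_iff _).mpr fun ε ↦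
    isPlot_smoothFn_mul ((isPlot_modS_iff p).mp hp ε) ((isPlot_modS_iff q).mp hq ε))
    fun u v ↦ (map_mul (GSpecial.mk Ω) u v).symm

lemma GSpecial.dSmooth_deriv (α : Fin n → ℕ) : DSmooth (GSpecial.deriv Ω α) :=
  dSmooth_quotient_map (GSpecial.mk_surjective Ω) (f := ModS.deriv Ω α)
    (fun k p hp ↦ (isPlot_modS_iff _).mpr fun ε ↦
    dSmooth_mderiv α k _ ((isPlot_modS_iff p).mp hp ε)) fun _ ↦ rfl

lemma GFull.dSmooth_add : DSmooth (fun p : GFull Ω × GFull Ω ↦ p.1 + p.2) :=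
  dSmooth_quotient_map₂ (GFull.mk_surjective Ω) (f := (· + ·))
    (fun _ p q hp hq ↦ (isPlot_modE_iff _).mpr fun φ ↦
    isPlot_smoothFn_add ((isPlot_modE_iff p).mp hp φ) ((isPlot_modE_iff q).mp hq φ))
    fun u v ↦ (map_add (GFull.mk Ω) u v).symm

lemma GFull.dSmooth_mul : DSmooth (fun p : GFull Ω × GFull Ω ↦ p.1 * p.2) :=
  dSmooth_quotient_map₂ (GFull.mk_surjective Ω) (f := (· * ·))
    (fun _ p q hp hq ↦ (isPlot_modE_iff _).mpr fun φ ↦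
    isPlot_smoothFn_mul ((isPlot_modE_iff p).mp hp φ) ((isPlot_modE_iff q).mp hq φ))
    fun u v ↦ (map_mul (GFull.mk Ω) u v).symm

lemma GFull.dSmooth_deriv (α : Fin n → ℕ) : DSmooth (GFull.deriv Ω α) :=
  dSmooth_quotient_map (GFull.mk_surjective Ω) (f := ModE.deriv Ω α)
    (fun k p hp ↦ (isPlot_modE_iff _).mpr fun φ ↦
    dSmooth_mderiv α k _ ((isPlot_modE_iff p).mp hp φ)) fun _ ↦ rfl

lemma dSmooth_GSpecial_mk : DSmooth (GSpecial.mk Ω) := dSmooth_quotient_mk (GSpecial.mk_surjective Ω)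

lemma dSmooth_GFull_mk : DSmooth (GFull.mk Ω) := dSmooth_quotient_mk (GFull.mk_surjective Ω)

lemma dSmooth_sigmaSpecial : DSmooth (sigmaSpecial : SmoothFn Ω → GSpecial Ω) := fun k _ hp ↦
  dSmooth_GSpecial_mk Ω k (fun _ ↦ ⟨_, _⟩) ((isPlot_modS_iff _).mpr fun _ ↦ hp)

lemma dSmooth_sigmaFull : DSmooth (sigmaFull : SmoothFn Ω → GFull Ω) := fun k _ hp ↦
  dSmooth_GFull_mk Ω k (fun _ ↦ ⟨_, _⟩) ((isPlot_modE_iff _).mpr fun φ ↦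
    isPlot_restrictFn (dom_le Ω φ) hp)

end Operations

/-! ### Nets that agree for small parameters -/

section Germs

variable {n : ℕ} {Ω : Opens (Eucl n)}

lemma tendsto_coe_zeroI : Tendsto (fun ε : EpsI ↦ (ε : ℝ)) zeroI (𝓝 0) := tendsto_comap

lemma isNegligibleS_of_eventually_eq_zero {u : SNets Ω} (h : ∀ᶠ ε in zeroI, u ε = 0) :
    IsNegligibleS u := fun K _ _ α m ↦ ⟨0, by
  filter_upwards [h] with ε hε x _
  have : netDeriv α u ε = 0 := by simp [netDeriv, hε]
  simp [this]⟩

/-- Estimates are made for one φ at a time, so the threshold for ε may depend on φ and q = 0 serves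
for every m. -/
lemma isNegligibleE_of_eventually_eq_zero {R : ENets Ω}
    (h : ∀ φ : A0 n, ∀ᶠ ε in zeroI, R (φ.scale ε) = 0) : IsNegligibleE R :=
  fun K _ _ α m ↦ ⟨0, fun φ _ ↦ ⟨0, by
    filter_upwards [h φ] with ε hε x _
    have : ENets.along (netDeriv α R) φ ε = 0 := by simp [netDeriv, ENets.along, hε]
    simp [this]⟩⟩

lemma IsNegligibleS.isModerateS {u : SNets Ω} (h : IsNegligibleS u) : IsModerateS u :=
  fun K hK hKΩ α ↦ ⟨0, by simpa using h K hK hKΩ α 0⟩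

lemma IsNegligibleE.isModerateE {R : ENets Ω} (h : IsNegligibleE R) : IsModerateE R :=
  fun K hK hKΩ α ↦ by
    obtain ⟨q, hq⟩ := h K hK hKΩ α 0
    -- The number q is used twice: to restrict φ to `Aq n q`, and as an exponent, since O(1) implies
    -- O(ε^(-q)).
    exact ⟨q, fun φ hφ ↦ (hq φ hφ).mono (by simp)⟩

lemma GSpecial.mk_eq_mk_iff {u v : ModS Ω} :
    GSpecial.mk Ω u = GSpecial.mk Ω v ↔ IsNegligibleS (u.1 - v.1) :=
  Ideal.Quotient.eq (I := NegS Ω)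

lemma GFull.mk_eq_mk_iff {u v : ModE Ω} :
    GFull.mk Ω u = GFull.mk Ω v ↔ IsNegligibleE (u.1 - v.1) :=
  Ideal.Quotient.eq (I := NegE Ω)

/-- Moderateness and the class depend only on the germ of the net at ε = 0. -/
lemma GSpecial.exists_mk_eq_of_eventually_eq (v : ModS Ω) {w : SNets Ω}
    (h : ∀ᶠ ε in zeroI, w ε = v.1 ε) :
    ∃ hw : w ∈ ModS Ω, GSpecial.mk Ω ⟨w, hw⟩ = GSpecial.mk Ω v := by
  have hn : IsNegligibleS (w - v.1) :=
    isNegligibleS_of_eventually_eq_zero (h.mono fun ε hε ↦ by simp [hε])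
  have hw : w ∈ ModS Ω := by
    simpa using (ModS Ω).add_mem (show w - v.1 ∈ ModS Ω from hn.isModerateS) v.2
  exact ⟨hw, GSpecial.mk_eq_mk_iff.mpr hn⟩

lemma GFull.exists_mk_eq_of_eventually_eq (v : ModE Ω) {w : ENets Ω}
    (h : ∀ φ : A0 n, ∀ᶠ ε in zeroI, w (φ.scale ε) = v.1 (φ.scale ε)) :
    ∃ hw : w ∈ ModE Ω, GFull.mk Ω ⟨w, hw⟩ = GFull.mk Ω v := by
  have hn : IsNegligibleE (w - v.1) :=
    isNegligibleE_of_eventually_eq_zero fun φ ↦ (h φ).mono fun ε hε ↦ by simp [hε]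
  have hw : w ∈ ModE Ω := by
    simpa using (ModE Ω).add_mem (show w - v.1 ∈ ModE Ω from hn.isModerateE) v.2
  exact ⟨hw, GFull.mk_eq_mk_iff.mpr hn⟩

end Germs

/-! ### The D-topologies -/

section DTopology

/-- If any point can be joined to any other one by a plot that leaves it at once, then the
D-topology is indiscrete. -/
lemma dTopology_eq_top {X : Type*} [DiffeologicalSpace X]
    (h : ∀ x y : X, ∃ p : Eucl 1 → X, IsPlot p ∧ p 0 = x ∧ ∀ t, t ≠ 0 → p t = y) :
    (dTopology : TopologicalSpace X) = ⊤ := by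
  refine eq_top_iff.mpr fun s hs ↦ ?_
  rw [TopologicalSpace.isOpen_top_iff]
  refine s.eq_empty_or_nonempty.imp_right fun ⟨x, hx⟩ ↦ eq_univ_of_forall fun y ↦ ?_
  obtain ⟨p, hp, h0, h1⟩ := h x y
  have ho : p ⁻¹' s ∈ 𝓝 0 :=
    (isOpen_iff_preimages_plots.mp hs 1 p hp).mem_nhds (by simpa [h0] using hx)
  -- The origin is not isolated, so the open set p⁻¹(s) around it contains some t ≠ 0, where p takes
  -- the value y.
  have hne : (𝓝[≠] (0 : Eucl 1)).NeBot := Module.punctured_nhds_neBot ℝ _ _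
  obtain ⟨t, ht, ht0⟩ := Filter.nonempty_of_mem
    (inter_mem (mem_nhdsWithin_of_mem_nhds ho) (self_mem_nhdsWithin (s := ({0}ᶜ : Set (Eucl 1)))))
  rw [mem_preimage, h1 t ht0] at ht
  exact ht

lemma isTopologicalRing_top (R : Type*) [CommRing R] : @IsTopologicalRing R ⊤ _ := by
  let : TopologicalSpace R := ⊤
  exact { continuous_add := continuous_top, continuous_mul := continuous_top,
          continuous_neg := continuous_top }

lemma continuousSMul_top (R : Type*) [CommRing R] [Algebra ℝ R] :
    @ContinuousSMul ℝ R _ _ ⊤ := by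
  let : TopologicalSpace R := ⊤
  exact { continuous_smul := continuous_top }

variable {n : ℕ}

section Join

variable {J : Type*} {O : J → Opens (Eucl n)}

/-- A curve of nets that passes from `u` to `v`, in the member `j` while `‖t‖² * s j ≤ 1`. -/
def joinNet (s : J → ℝ) (u v : Nets O) (t : Eucl 1) : Nets O :=
  fun j ↦ u j + Real.smoothTransition (‖t‖ ^ 2 * s j) • (v j - u j)

lemma joinNet_zero (s : J → ℝ) (u v : Nets O) : joinNet s u v 0 = u := by
  funext j; simp [joinNet]

lemma joinNet_apply_of_one_le {s : J → ℝ} (u v : Nets O) {t : Eucl 1} {j : J}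
    (h : 1 ≤ ‖t‖ ^ 2 * s j) : joinNet s u v t j = v j := by
  simp [joinNet, Real.smoothTransition.one_of_one_le h]

lemma isPlot_joinNet (s : J → ℝ) (u v : Nets O) (j : J) : IsPlot fun t ↦ joinNet s u v t j := by
  refine isPlot_smoothFn_add isPlot_const (isPlot_smoothFn_smul ?_ isPlot_const)
  exact Real.smoothTransition.contDiff.comp ((contDiff_norm_sq ℝ).mul contDiff_const)

end Join

variable (Ω : Opens (Eucl n))

/-- With weight 1/ε, for t ≠ 0 the transition to v is complete once ε ≤ ‖t‖². For fixed ε the curve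
is smooth through t = 0, where it equals u. -/
lemma GSpecial.dTopology_eq_top : (dTopology : TopologicalSpace (GSpecial Ω)) = ⊤ := by
  refine Colombeau.dTopology_eq_top fun x y ↦ ?_
  obtain ⟨u, rfl⟩ := GSpecial.mk_surjective Ω x
  obtain ⟨v, rfl⟩ := GSpecial.mk_surjective Ω y
  let s : EpsI → ℝ := fun ε ↦ (ε : ℝ)⁻¹
  have h (t : Eucl 1) (ht : t ≠ 0) : ∀ᶠ ε in zeroI, joinNet s u.1 v.1 t ε = v.1 ε := by
    have ht' : 0 < ‖t‖ ^ 2 := by positivity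
    filter_upwards [tendsto_coe_zeroI.eventually_le_const ht'] with ε hε
    exact joinNet_apply_of_one_le _ _ ((one_le_div₀ ε.2.1).mpr hε)
  have hm (t : Eucl 1) : joinNet s u.1 v.1 t ∈ ModS Ω := by
    by_cases ht : t = 0
    · rw [ht, joinNet_zero]; exact u.2
    · exact (exists_mk_eq_of_eventually_eq v (h t ht)).1
  refine ⟨fun t ↦ GSpecial.mk Ω ⟨_, hm t⟩, dSmooth_GSpecial_mk Ω 1 _
    ((isPlot_modS_iff _).mpr (isPlot_joinNet s u.1 v.1)), ?_, fun t ht ↦ ?_⟩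
  · exact congrArg _ (Subtype.ext (joinNet_zero s u.1 v.1))
  · exact (exists_mk_eq_of_eventually_eq v (h t ht)).2

/-- The supremum norm of an element of `𝓐₀`. -/
def A0.supNorm (φ : A0 n) : ℝ := ⨆ x, |φ.1 x|

lemma A0.supNorm_pos (φ : A0 n) : 0 < φ.supNorm := by
  obtain ⟨C, hC⟩ := φ.1.continuous.bounded_above_of_compact_support φ.1.hasCompactSupport
  have hb : BddAbove (range fun x ↦ |φ.1 x|) := ⟨C, by rintro _ ⟨x, rfl⟩; exact hC x⟩
  by_contra hn
  have h0 (x : Eucl n) : φ.1 x = 0 :=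
    abs_nonpos_iff.mp ((le_ciSup hb x).trans (not_lt.mp hn))
  have := φ.2
  simp [h0] at this

lemma A0.supNorm_scale (ε : EpsI) (φ : A0 n) :
    (φ.scale ε).supNorm = ((ε : ℝ) ^ n)⁻¹ * φ.supNorm := by
  have hε : (0 : ℝ) < ((ε : ℝ) ^ n)⁻¹ := by have := ε.2.1; positivity
  rw [A0.supNorm, A0.supNorm, Real.mul_iSup_of_nonneg hε.le]
  rw [← (Homeomorph.smulOfNeZero (ε : ℝ)⁻¹ (inv_ne_zero ε.2.1.ne')).surjective.iSup_comp
    (fun x ↦ ((ε : ℝ) ^ n)⁻¹ * |φ.1 x|)]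
  refine iSup_congr fun x ↦ ?_
  change |((ε : ℝ) ^ n)⁻¹ * φ.1 ((ε : ℝ)⁻¹ • x)| = _
  rw [abs_mul, abs_of_pos hε]
  rfl

/-- The parameter ε is not a variable of R, so the weight must be read off from the test function:
the sup norm of ε ⊙ φ is ε⁻ⁿ times that of φ, and tends to infinity exactly because n ≠ 0. -/
lemma GFull.dTopology_eq_top (hn : n ≠ 0) : (dTopology : TopologicalSpace (GFull Ω)) = ⊤ := by
  refine Colombeau.dTopology_eq_top fun x y ↦ ?_
  obtain ⟨u, rfl⟩ := GFull.mk_surjective Ω x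
  obtain ⟨v, rfl⟩ := GFull.mk_surjective Ω y
  let s : A0 n → ℝ := A0.supNorm
  have h (t : Eucl 1) (ht : t ≠ 0) (φ : A0 n) :
      ∀ᶠ ε in zeroI, joinNet s u.1 v.1 t (φ.scale ε) = v.1 (φ.scale ε) := by
    have ht' : 0 < ‖t‖ ^ 2 * φ.supNorm := mul_pos (by positivity) φ.supNorm_pos
    have h0 : Tendsto (fun ε : EpsI ↦ (ε : ℝ) ^ n) zeroI (𝓝 0) := by
      simpa [hn] using tendsto_coe_zeroI.pow n
    filter_upwards [h0.eventually_le_const ht'] with ε hε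
    refine joinNet_apply_of_one_le _ _ ?_
    have hεn : 0 < (ε : ℝ) ^ n := pow_pos ε.2.1 n
    change 1 ≤ ‖t‖ ^ 2 * (φ.scale ε).supNorm
    rw [A0.supNorm_scale, mul_left_comm, ← div_eq_inv_mul]
    exact (one_le_div₀ hεn).mpr hε
  have hm (t : Eucl 1) : joinNet s u.1 v.1 t ∈ ModE Ω := by
    by_cases ht : t = 0
    · rw [ht, joinNet_zero]; exact u.2
    · exact (exists_mk_eq_of_eventually_eq v (h t ht)).1
  refine ⟨fun t ↦ GFull.mk Ω ⟨_, hm t⟩, dSmooth_GFull_mk Ω 1 _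
    ((isPlot_modE_iff _).mpr (isPlot_joinNet s u.1 v.1)), ?_, fun t ht ↦ ?_⟩
  · exact congrArg _ (Subtype.ext (joinNet_zero s u.1 v.1))
  · exact (exists_mk_eq_of_eventually_eq v (h t ht)).2

end DTopology

/-! ### The full algebra in dimension zero -/

section DimensionZero

/-- On a one-point space φ is the number φ(0), and the integral condition determines it. -/
lemma A0.eq_of_dim_zero (φ φ' : A0 0) : φ = φ' := by
  have key (φ : A0 0) : (volume : Measure (Eucl 0)).real univ * φ.1 0 = 1 := by
    have h := φ.2
    rwa [show (fun x : Eucl 0 ↦ φ.1 x) = fun _ ↦ φ.1 0 from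
      funext fun x ↦ congrArg _ (Subsingleton.elim x 0), integral_const, smul_eq_mul] at h
  have hv := left_ne_zero_of_mul_eq_one (key φ)
  refine Subtype.ext (TestFunction.ext fun x ↦ ?_)
  rw [Subsingleton.elim x 0]
  exact mul_left_cancel₀ hv ((key φ).trans (key φ').symm)

instance zeroI_neBot : zeroI.NeBot := by
  rw [zeroI, comap_neBot_iff]
  intro s hs
  obtain ⟨x, hxs, hx⟩ := Filter.nonempty_of_mem
    (inter_mem (mem_nhdsWithin_of_mem_nhds hs) (Ioc_mem_nhdsGT (zero_lt_one (α := ℝ))))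
  exact ⟨⟨x, hx⟩, hxs⟩

variable {Ω : Opens (Eucl 0)}

/-- In dimension zero the elements of the full algebra are real numbers, by evaluation. -/
lemma GFull.exists_eval (φ₀ : A0 0) (x₀ : Eucl 0) (hx₀ : x₀ ∈ dom Ω φ₀) :
    ∃ e : GFull Ω →+* ℝ, DSmooth e ∧ ∀ g, algebraMap ℝ (GFull Ω) (e g) = g := by
  let f : ModE Ω →+* ℝ :=
    { toFun := fun R ↦ (R.1 φ₀).1 ⟨x₀, hx₀⟩
      map_one' := rfl
      map_mul' := fun _ _ ↦ rfl
      map_zero' := rfl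
      map_add' := fun _ _ ↦ rfl }
  have hval (R : ENets Ω) (φ : A0 0) (x : dom Ω φ) : (R φ).1 x = (R φ₀).1 ⟨x₀, hx₀⟩ := by
    obtain rfl := A0.eq_of_dim_zero φ φ₀
    exact congrArg _ (Subtype.ext (Subsingleton.elim _ _))
  -- As 𝓐₀ is a single point, R(ε ⊙ φ₀, x₀) does not depend on ε, and a constant that is O(ε)
  -- vanishes. The moment conditions on φ₀ are vacuous: in dimension zero no multi-index has
  -- positive order.
  have hf : ∀ R ∈ NegE Ω, f R = 0 := by
    intro R hR
    obtain ⟨q, hq⟩ := hR {x₀} isCompact_singleton (singleton_subset_iff.mpr hx₀.1) 0 1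
    obtain ⟨C, hC⟩ := hq φ₀ fun α h ↦ by simp at h
    have h0 : netDeriv 0 R.1 = R.1 := by funext j; simp [netDeriv, mderiv]
    rw [h0] at hC
    have hlim : Tendsto (fun ε : EpsI ↦ C * (ε : ℝ) ^ ((1 : ℕ) : ℤ)) zeroI (𝓝 0) := by
      simpa using tendsto_coe_zeroI.const_mul C
    refine abs_nonpos_iff.mp (ge_of_tendsto hlim ?_)
    filter_upwards [hC] with ε hε
    have hx : x₀ ∈ dom Ω (φ₀.scale ε) := by rwa [A0.eq_of_dim_zero (φ₀.scale ε) φ₀]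
    have := hε ⟨x₀, hx⟩ rfl
    rwa [show (R.1.along φ₀ ε).1 ⟨x₀, hx⟩ = f R from hval R.1 _ _] at this
  refine ⟨Ideal.Quotient.lift (NegE Ω) f hf, fun k p hp ↦ ?_, fun g ↦ ?_⟩
  · refine ContDiff.isPlot (contDiff_iff_contDiffAt.mpr fun t ↦ ?_)
    obtain ⟨δ, hδ, h⟩ := hp t
    have h1 : ContDiff ℝ ∞ fun t ↦ f (δ t) := IsPlot.contDiff
      ((isPlot_modE_iff δ).mp hδ φ₀ k (fun s ↦ (s, ⟨x₀, hx₀⟩)) ⟨isPlot_id, isPlot_const⟩)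
    refine h1.contDiffAt.congr_of_eventuallyEq ?_
    filter_upwards [h] with s hs
    rw [Function.comp_apply, hs]
    rfl
  · obtain ⟨R, rfl⟩ := GFull.mk_surjective Ω g
    refine congrArg (GFull.mk Ω) (a₁ := algebraMap ℝ (ModE Ω) (f R)) (Subtype.ext ?_)
    funext φ
    exact Subtype.ext (funext fun x ↦ (hval R.1 φ x).symm)

/-- All members are functions on the empty set. In dimension zero this is the case in which
`GFull.exists_eval` has no point to evaluate at. -/
lemma GFull.subsingleton_of_forall_notMem {n : ℕ} {Ω : Opens (Eucl n)}
    (h : ∀ φ x, x ∉ dom Ω φ) : Subsingleton (GFull Ω) := by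
  refine ⟨fun x y ↦ ?_⟩
  obtain ⟨u, rfl⟩ := GFull.mk_surjective Ω x
  obtain ⟨v, rfl⟩ := GFull.mk_surjective Ω y
  refine GFull.mk_eq_mk_iff.mpr (isNegligibleE_of_eventually_eq_zero fun φ ↦ ?_)
  exact Eventually.of_forall fun ε ↦ Subtype.ext (funext fun x ↦ (h _ x x.2).elim)

lemma dSmooth_algebraMap_GFull {n : ℕ} {Ω : Opens (Eucl n)} :
    DSmooth (algebraMap ℝ (GFull Ω)) := fun k p hp ↦ by
  have h := dSmooth_GFull_mk Ω k (fun t ↦ algebraMap ℝ (ModE Ω) (p t))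
    ((isPlot_modE_iff _).mpr fun φ ↦ by
      refine (isPlot_smoothFn_iff _).mpr ?_
      refine ((IsPlot.contDiff hp).comp contDiff_fst).contDiffOn.congr fun z hz ↦ ?_
      exact ext_of_mem _ hz)
  exact h

end DimensionZero

/-! ### Continuity of the algebra operations -/

section TopologicalAlgebra

variable {n : ℕ} (Ω : Opens (Eucl n))

lemma GSpecial.isTopologicalRing : @IsTopologicalRing (GSpecial Ω) dTopology _ := by
  rw [GSpecial.dTopology_eq_top]; exact isTopologicalRing_top _

lemma GSpecial.continuousSMul : @ContinuousSMul ℝ (GSpecial Ω) _ _ dTopology := by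
  rw [GSpecial.dTopology_eq_top]; exact continuousSMul_top _

/-- Outside the indiscrete case n = 0 and some domain is nonempty. Each operation then factors
through ℝ, as e, the operation of ℝ, and `algebraMap`; these are continuous, so the product topology
causes no difficulty. -/
lemma GFull.isTopologicalAlgebra : @IsTopologicalRing (GFull Ω) dTopology _ ∧
    @ContinuousSMul ℝ (GFull Ω) _ _ dTopology := by
  by_cases htop : (dTopology : TopologicalSpace (GFull Ω)) = ⊤
  · rw [htop]; exact ⟨isTopologicalRing_top _, continuousSMul_top _⟩
  obtain rfl : n = 0 := by_contra fun hn ↦ htop (GFull.dTopology_eq_top Ω hn)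
  by_cases hΩ : ∀ φ x, x ∉ dom Ω φ
  · have := GFull.subsingleton_of_forall_notMem hΩ
    exact (htop (Subsingleton.elim _ _)).elim
  push Not at hΩ
  obtain ⟨φ₀, x₀, hx₀⟩ := hΩ
  obtain ⟨e, he, hae⟩ := GFull.exists_eval φ₀ x₀ hx₀
  let : TopologicalSpace (GFull Ω) := dTopology
  have hc : Continuous e := he.continuous
  have ha : Continuous (algebraMap ℝ (GFull Ω)) := dSmooth_algebraMap_GFull.continuous
  constructor
  · refine { continuous_add := ?_, continuous_mul := ?_, continuous_neg := ?_ }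
    · refine (ha.comp ((hc.comp continuous_fst).add (hc.comp continuous_snd))).congr fun z ↦ ?_
      simp [hae]
    · refine (ha.comp ((hc.comp continuous_fst).mul (hc.comp continuous_snd))).congr fun z ↦ ?_
      simp [hae]
    · refine (ha.comp hc.neg).congr fun z ↦ ?_
      simp [hae]
  · refine { continuous_smul := ?_ }
    refine (ha.comp (continuous_fst.mul (hc.comp continuous_snd))).congr fun z ↦ ?_
    simp [hae, Algebra.smul_def]

end TopologicalAlgebra

/-! ### Estimates for functionals on test functions -/

section Remainder

/-- The remainder of the first order Taylor expansion of a test function is of second order,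
together with all its derivatives. -/
lemma exists_norm_iteratedFDeriv_remainder_le {E F : Type} [NormedAddCommGroup E] [NormedSpace ℝ E]
    [NormedAddCommGroup F] [NormedSpace ℝ F] (j : ℕ) {f : E → F} (hf : ContDiff ℝ ∞ f)
    (hc : HasCompactSupport f) : ∃ M : ℝ, 0 ≤ M ∧ ∀ h z,
      ‖iteratedFDeriv ℝ j (fun z ↦ f (z - h) - f z + fderiv ℝ f z h) z‖ ≤ M * ‖h‖ ^ 2 := by
  have hf' : ContDiff ℝ ∞ (fderiv ℝ f) := hf.fderiv_right (by simp)
  induction j generalizing F with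
  | zero =>
    obtain ⟨M, hM⟩ := hf'.lipschitzWith_of_hasCompactSupport (hc.fderiv ℝ) (by simp)
    refine ⟨M, M.2, fun h z ↦ ?_⟩
    rw [norm_iteratedFDeriv_zero]
    have hb : ∀ x ∈ Metric.closedBall z ‖h‖, ‖fderiv ℝ f x - fderiv ℝ f z‖ ≤ M * ‖h‖ :=
      fun x hx ↦ by
        rw [← dist_eq_norm]
        exact (hM.dist_le_mul x z).trans (by gcongr; exact hx)
    -- Mean value inequality on the ball of radius ‖h‖, where the derivative varies by at most M‖h‖.
    have := (convex_closedBall z ‖h‖).norm_image_sub_le_of_norm_fderiv_le'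
      (fun x _ ↦ (hf.differentiable (by simp)).differentiableAt) hb
      (Metric.mem_closedBall_self (norm_nonneg h)) (y := z - h) (by simp)
    simpa [sq, mul_assoc] using this
  | succ j ih =>
    obtain ⟨M, hM0, hM⟩ := ih hf' (hc.fderiv ℝ) (hf'.fderiv_right (by simp))
    refine ⟨M, hM0, fun h z ↦ ?_⟩
    rw [← norm_iteratedFDeriv_fderiv]
    -- The derivative of the remainder of f is the remainder of Df, which lets the induction run
    -- over the target space F. Symmetry of D²f exchanges the direction of differentiation with h.
    have key : fderiv ℝ (fun z ↦ f (z - h) - f z + fderiv ℝ f z h)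
        = fun z ↦ fderiv ℝ f (z - h) - fderiv ℝ f z + fderiv ℝ (fderiv ℝ f) z h := by
      funext z
      have hd : Differentiable ℝ f := hf.differentiable (by simp)
      have hd' : Differentiable ℝ (fderiv ℝ f) := hf'.differentiable (by simp)
      have h1 : DifferentiableAt ℝ (fun z ↦ f (z - h)) z :=
        hd.differentiableAt.comp z (differentiableAt_id.sub_const h)
      have h2 : DifferentiableAt ℝ (fun z ↦ fderiv ℝ f z h) z :=
        hd'.differentiableAt.clm_apply (differentiableAt_const h)
      rw [fderiv_fun_add (h1.fun_sub hd.differentiableAt) h2, fderiv_fun_sub h1 hd.differentiableAt,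
        fderiv_comp_sub]
      congr 1
      ext k
      rw [fderiv_clm_apply hd'.differentiableAt (differentiableAt_const h)]
      have hs : IsSymmSndFDerivAt ℝ f z :=
        hf.contDiffAt.isSymmSndFDerivAt (by simp; norm_cast)
      simpa using hs.eq k h
    rw [key]
    exact hM h z

end Remainder

/-! ### Pairing a functional with translates of a test function -/

section Pairing

variable {n : ℕ} {Ω : Opens (Eucl n)}

/-- A continuous linear functional on test functions is bounded, on the test functions with support
in a compact set, by finitely many derivatives. -/
lemma exists_abs_le_of_iteratedFDeriv_le (L : 𝓓(Ω, ℝ) →L[ℝ] ℝ) {K : Set (Eucl n)}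
    (hK : IsCompact K) (hKΩ : K ⊆ Ω) : ∃ (m : ℕ) (C : ℝ), 0 ≤ C ∧ ∀ χ : 𝓓(Ω, ℝ),
      (∀ y ∉ K, χ y = 0) → ∀ B : ℝ, 0 ≤ B → (∀ j ≤ m, ∀ y, ‖iteratedFDeriv ℝ j χ y‖ ≤ B) →
        |L χ| ≤ C * B := by
  let K' : Compacts (Eucl n) := ⟨K, hK⟩
  let T : 𝓓_{K'}(Eucl n, ℝ) →L[ℝ] ℝ := L.comp (TestFunction.ofSupportedInCLM ℝ hKΩ)
  obtain ⟨s, C, -, hC⟩ := Seminorm.bound_of_continuous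
    (ContDiffMapSupportedIn.withSeminorms ℝ (Eucl n) ℝ ⊤ K')
    ((normSeminorm ℝ ℝ).comp T.toLinearMap) (continuous_norm.comp T.continuous)
  -- The order m is the largest index among the finitely many seminorms that bound L.
  refine ⟨s.sup id, C, C.2, fun χ hχ B hB hj ↦ ?_⟩
  let χ' : 𝓓_{K'}(Eucl n, ℝ) := ⟨χ, χ.contDiff, fun y hy ↦ hχ y hy⟩
  have h1 : TestFunction.ofSupportedIn hKΩ χ' = χ := rfl
  have h2 : |L χ| ≤ C * (s.sup (ContDiffMapSupportedIn.seminorm ℝ (Eucl n) ℝ ⊤ K')) χ' := hC χ'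
  refine h2.trans (mul_le_mul_of_nonneg_left ?_ C.2)
  refine Seminorm.finset_sup_apply_le hB fun j hjs ↦ ?_
  exact (ContDiffMapSupportedIn.seminorm_top_le_iff ℝ hB j χ').mpr fun y _ ↦
    hj j (Finset.le_sup (f := id) hjs) y

variable (Ω) in
/-- The open set of those `x ∈ Ω` for which `φ(· - x)` is supported in `Ω`. -/
def transDom (φ : DR n) : Opens (Eucl n) where
  carrier := {x | x ∈ Ω ∧ ∀ y ∈ tsupport φ, y + x ∈ Ω}
  is_open' := by
    refine Ω.isOpen.inter (isOpen_iff_eventually.mpr fun x hx ↦ ?_)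
    refine φ.hasCompactSupport.isCompact.eventually_forall_of_forall_eventually fun y hy ↦ ?_
    exact (continuous_snd.add continuous_fst).continuousAt.eventually
      (Ω.isOpen.mem_nhds (hx y hy))

lemma transDom_mono {φ θ : DR n} (h : tsupport θ ⊆ tsupport φ) : transDom Ω φ ≤ transDom Ω θ :=
  fun _ hx ↦ ⟨hx.1, fun y hy ↦ hx.2 y (h hy)⟩

/-- The translate `φ(· - x)` of a test function, for `x` such that it is supported in `Ω`. -/
def translate (φ : DR n) (x : Eucl n) (hx : x ∈ transDom Ω φ) : 𝓓(Ω, ℝ) where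
  toFun y := φ (y - x)
  contDiff' := φ.contDiff.comp (contDiff_id.sub contDiff_const)
  hasCompactSupport' := φ.hasCompactSupport.comp_homeomorph (Homeomorph.subRight x)
  tsupport_subset' := fun y hy ↦ by
    have h : y - x ∈ tsupport φ :=
      tsupport_comp_subset_preimage φ (f := fun y ↦ y - x) (by fun_prop) hy
    simpa using hx.2 _ h

@[simp] lemma translate_apply (φ : DR n) (x : Eucl n) (hx : x ∈ transDom Ω φ) (y : Eucl n) :
    translate φ x hx y = φ (y - x) := rfl

open Classical in
/-- The function `x ↦ ⟨L, φ(· - x)⟩`. -/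
def pair (L : 𝓓(Ω, ℝ) →L[ℝ] ℝ) (φ : DR n) (x : Eucl n) : ℝ :=
  if h : x ∈ transDom Ω φ then L (translate φ x h) else 0

lemma pair_of_mem (L : 𝓓(Ω, ℝ) →L[ℝ] ℝ) {φ : DR n} {x : Eucl n} (h : x ∈ transDom Ω φ) :
    pair L φ x = L (translate φ x h) := dif_pos h

/-- The partial derivative `∂ᵢ φ` of a test function. -/
def DR.pd (i : Fin n) (φ : DR n) : DR n where
  toFun z := fderiv ℝ φ z (EuclideanSpace.single i 1)
  contDiff' := (φ.contDiff.fderiv_right (by simp)).clm_apply contDiff_const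
  hasCompactSupport' := φ.hasCompactSupport.fderiv_apply ℝ _
  tsupport_subset' := fun _ _ ↦ trivial

lemma DR.pd_apply (i : Fin n) (φ : DR n) (z : Eucl n) :
    φ.pd i z = fderiv ℝ φ z (EuclideanSpace.single i 1) := rfl

lemma DR.tsupport_pd_subset (i : Fin n) (φ : DR n) : tsupport (φ.pd i) ⊆ tsupport φ :=
  tsupport_fderiv_apply_subset ℝ _

lemma DR.sum_mul_pd (φ : DR n) (z h : Eucl n) : ∑ i, h i * φ.pd i z = fderiv ℝ φ z h := by
  conv_rhs => rw [← (EuclideanSpace.basisFun (Fin n) ℝ).sum_repr h, map_sum]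
  simp [DR.pd_apply]

open scoped Pointwise in
-- The Taylor remainder of the translate, as a test function, is O(‖h‖²) in every derivative and
-- supported in a fixed compact set, so L maps it to o(‖h‖). The sign comes from φ(· - x).
lemma hasFDerivAt_pair (L : 𝓓(Ω, ℝ) →L[ℝ] ℝ) (φ : DR n) {x : Eucl n} (hx : x ∈ transDom Ω φ) :
    HasFDerivAt (pair L φ)
      (-∑ i, pair L (φ.pd i) x • (EuclideanSpace.proj i : Eucl n →L[ℝ] ℝ)) x := by
  obtain ⟨r, hr, hrx⟩ := Metric.nhds_basis_closedBall.mem_iff.mp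
    ((transDom Ω φ).isOpen.mem_nhds hx)
  -- This compact subset of Ω contains the supports of φ(· - a) for all a within r of x.
  let K := Metric.closedBall x r + tsupport φ
  have hK : IsCompact K := (isCompact_closedBall x r).add φ.hasCompactSupport
  have hKΩ : K ⊆ Ω := by
    rintro _ ⟨a, ha, b, hb, rfl⟩
    change a + b ∈ Ω
    rw [add_comm]
    exact (hrx ha).2 b hb
  have hKz {a y : Eucl n} (ha : a ∈ Metric.closedBall x r) (hy : y ∉ K) : y - a ∉ tsupport φ :=
    fun h ↦ hy ⟨a, ha, _, h, by simp⟩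
  have hxr : x ∈ Metric.closedBall x r := Metric.mem_closedBall_self hr.le
  obtain ⟨m, C, hC0, hC⟩ := exists_abs_le_of_iteratedFDeriv_le L hK hKΩ
  choose M hM0 hM using fun j ↦
    exists_norm_iteratedFDeriv_remainder_le j φ.contDiff φ.hasCompactSupport
  let M' := ∑ j ∈ Finset.range (m + 1), M j
  have hM' {j : ℕ} (hj : j ≤ m) : M j ≤ M' :=
    Finset.single_le_sum (fun j _ ↦ hM0 j) (Finset.mem_range.mpr (by omega))
  have hM'0 : 0 ≤ M' := Finset.sum_nonneg fun j _ ↦ hM0 j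
  have hpd (i : Fin n) : x ∈ transDom Ω (φ.pd i) := transDom_mono (φ.tsupport_pd_subset i) hx
  rw [hasFDerivAt_iff_isLittleO_nhds_zero]
  refine (Asymptotics.IsBigO.of_bound (C * M') ?_).trans_isLittleO
    (Asymptotics.isLittleO_norm_pow_id one_lt_two)
  filter_upwards [Metric.closedBall_mem_nhds (0 : Eucl n) hr] with h hh
  have hxh' : x + h ∈ Metric.closedBall x r := by simpa using hh
  have hxh : x + h ∈ transDom Ω φ := hrx hxh'
  -- The Taylor remainder assembled inside 𝓓(Ω), so that L χ is the error of the linear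
  -- approximation.
  let χ : 𝓓(Ω, ℝ) := translate φ (x + h) hxh - translate φ x hx
    + ∑ i, h i • translate (φ.pd i) x (hpd i)
  have hχ (y : Eucl n) : χ y = φ (y - x - h) - φ (y - x) + fderiv ℝ φ (y - x) h := by
    rw [← DR.sum_mul_pd]
    simp [χ, sub_sub]
  have hχ0 : ∀ y ∉ K, χ y = 0 := fun y hy ↦ by
    have h1 := image_eq_zero_of_notMem_tsupport (hKz hxh' hy)
    have h2 := image_eq_zero_of_notMem_tsupport (hKz hxr hy)
    have h3 : fderiv ℝ φ (y - x) = 0 := by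
      by_contra h3
      exact hKz hxr hy (support_fderiv_subset ℝ h3)
    rw [hχ, sub_sub, h1, h2, h3]
    simp
  have hχL : pair L φ (x + h) - pair L φ x
      - (-∑ i, pair L (φ.pd i) x • (EuclideanSpace.proj i : Eucl n →L[ℝ] ℝ)) h = L χ := by
    rw [pair_of_mem L hxh, pair_of_mem L hx]
    simp [χ, pair_of_mem L (hpd _), mul_comm]
  rw [hχL, Real.norm_eq_abs, mul_assoc, norm_pow, norm_norm]
  refine hC χ hχ0 _ (by positivity) fun j hj y ↦ ?_
  have e : (χ : Eucl n → ℝ)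
      = fun y ↦ (fun z ↦ φ (z - h) - φ z + fderiv ℝ φ z h) (y - x) := funext hχ
  rw [e]
  refine (congrArg norm (iteratedFDeriv_comp_sub
    (f := fun z ↦ φ (z - h) - φ z + fderiv ℝ φ z h) j x y)).trans_le ?_
  exact (hM j h (y - x)).trans (by gcongr; exact hM' hj)

/-- The derivative consists of pairings of the same kind, with ∂ᵢφ in place of φ; hence induction
over all φ at once. -/
lemma contDiffOn_pair (L : 𝓓(Ω, ℝ) →L[ℝ] ℝ) (φ : DR n) :
    ContDiffOn ℝ ∞ (pair L φ) (transDom Ω φ) := by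
  refine contDiffOn_infty.mpr fun m ↦ ?_
  induction m generalizing φ with
  | zero => exact contDiffOn_zero.mpr fun x hx ↦
      (hasFDerivAt_pair L φ hx).continuousAt.continuousWithinAt
  | succ m ih =>
    rw [Nat.cast_succ, contDiffOn_succ_iff_fderiv_of_isOpen (transDom Ω φ).isOpen]
    refine ⟨fun x hx ↦ (hasFDerivAt_pair L φ hx).differentiableAt.differentiableWithinAt,
      by simp, ?_⟩
    refine ContDiffOn.congr ?_ fun x hx ↦ (hasFDerivAt_pair L φ hx).fderiv
    have h (i : Fin n) : ContDiffOn ℝ m (pair L (φ.pd i)) (transDom Ω φ) :=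
      (ih (φ.pd i)).mono (transDom_mono (φ.tsupport_pd_subset i))
    exact (ContDiffOn.sum fun i _ ↦ (h i).smul contDiffOn_const).neg

/-- The smooth function `x ↦ ⟨L, φ(· - x)⟩`. -/
def pairFn (L : 𝓓(Ω, ℝ) →L[ℝ] ℝ) (φ : DR n) : SmoothFn (transDom Ω φ) :=
  ⟨fun x ↦ pair L φ x, (contDiffOn_pair L φ).congr fun _ hx ↦ ext_of_mem _ hx⟩

/-- The iterated partial derivative of a test function along a word of indices. -/
def DR.wordPd : List (Fin n) → DR n → DR n
  | [], φ => φ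
  | i :: l, φ => (DR.wordPd l φ).pd i

lemma DR.tsupport_wordPd_subset (l : List (Fin n)) (φ : DR n) :
    tsupport (DR.wordPd l φ) ⊆ tsupport φ := by
  induction l with
  | nil => exact subset_rfl
  | cons i l ih => exact (DR.tsupport_pd_subset i _).trans ih

lemma mderiv_pairFn (L : 𝓓(Ω, ℝ) →L[ℝ] ℝ) (φ : DR n) (α : Fin n → ℕ) (x : transDom Ω φ) :
    (mderiv α (pairFn L φ)).1 x
      = (-1) ^ (multiWord α).length * pair L (DR.wordPd (multiWord α) φ) x := by
  have key (l : List (Fin n)) (x : transDom Ω φ) :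
      ((l.map fun i ↦ (pderiv i : Module.End ℝ (SmoothFn (transDom Ω φ)))).prod (pairFn L φ)).1 x
        = (-1) ^ l.length * pair L (DR.wordPd l φ) x := by
    induction l generalizing x with
    | nil => simp [DR.wordPd, pairFn]
    | cons i l ih =>
      rw [List.map_cons, List.prod_cons, Module.End.mul_apply]
      set g := (l.map fun i ↦ (pderiv i : Module.End ℝ (SmoothFn (transDom Ω φ)))).prod (pairFn L φ)
      change fderiv ℝ (ext g.1) x (EuclideanSpace.single i 1) = _
      have hx := transDom_mono (DR.tsupport_wordPd_subset l φ) x.2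
      have h : ext g.1 =ᶠ[𝓝 (x : Eucl n)] fun y ↦ (-1) ^ l.length * pair L (DR.wordPd l φ) y := by
        filter_upwards [(transDom Ω φ).isOpen.mem_nhds x.2] with y hy
        exact (ext_of_mem _ hy).trans (ih ⟨y, hy⟩)
      rw [h.fderiv_eq, ((hasFDerivAt_pair L (DR.wordPd l φ) hx).const_mul _).fderiv]
      simp [DR.wordPd, pow_succ]
  have := congrFun (netDeriv_eq α fun _ : Unit ↦ pairFn L φ) ()
  change mderiv α (pairFn L φ) = _ at this
  rw [this]
  exact key _ x

/-- Each ∂ᵢ is the full derivative evaluated at a unit vector, so it costs one order and no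
constant. -/
lemma DR.norm_iteratedFDeriv_wordPd_le (l : List (Fin n)) (φ : DR n) (j : ℕ) {B : ℝ}
    (h : ∀ z, ‖iteratedFDeriv ℝ (j + l.length) φ z‖ ≤ B) (z : Eucl n) :
    ‖iteratedFDeriv ℝ j (DR.wordPd l φ) z‖ ≤ B := by
  induction l generalizing j z with
  | nil => exact h z
  | cons i l ih =>
    have hφ : ContDiff ℝ ∞ (fderiv ℝ (DR.wordPd l φ)) :=
      (DR.wordPd l φ).contDiff.fderiv_right (by simp)
    refine (norm_iteratedFDeriv_clm_apply_const (N := ∞) (n := j) hφ.contDiffAt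
      (by exact_mod_cast le_top)).trans ?_
    rw [norm_iteratedFDeriv_fderiv]
    have := ih (j + 1) (fun z ↦ by
      have := h z
      rwa [List.length_cons, ← add_assoc, add_right_comm] at this) z
    simpa using this

/-- Near a compact set, the pairing with translates of test functions of small support is bounded
by finitely many derivatives. -/
lemma exists_abs_pair_le (L : 𝓓(Ω, ℝ) →L[ℝ] ℝ) {K : Set (Eucl n)} (hK : IsCompact K)
    (hKΩ : K ⊆ Ω) : ∃ δ > 0, ∃ (m : ℕ) (C : ℝ), 0 ≤ C ∧ ∀ θ : DR n,
      tsupport θ ⊆ Metric.closedBall 0 δ → ∀ x ∈ K, x ∈ transDom Ω θ ∧ ∀ B : ℝ, 0 ≤ B →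
        (∀ j ≤ m, ∀ z, ‖iteratedFDeriv ℝ j θ z‖ ≤ B) → |pair L θ x| ≤ C * B := by
  -- The closed δ-thickening of K contains the supports of all translates involved, so m and C do
  -- not depend on θ or x.
  obtain ⟨δ, hδ, hδK⟩ := hK.exists_cthickening_subset_open Ω.isOpen hKΩ
  obtain ⟨m, C, hC0, hC⟩ := exists_abs_le_of_iteratedFDeriv_le L hK.cthickening hδK
  have hmem {x y : Eucl n} (hx : x ∈ K) (hy : y ∈ Metric.closedBall 0 δ) :
      y + x ∈ Metric.cthickening δ K :=
    Metric.mem_cthickening_of_dist_le _ x _ _ hx (by simpa [dist_eq_norm] using hy)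
  refine ⟨δ, hδ, m, C, hC0, fun θ hθ x hx ↦ ?_⟩
  have hxθ : x ∈ transDom Ω θ := ⟨hKΩ hx, fun y hy ↦ hδK (hmem hx (hθ hy))⟩
  refine ⟨hxθ, fun B hB hj ↦ ?_⟩
  rw [pair_of_mem L hxθ]
  refine hC _ (fun y hy ↦ ?_) B hB fun j hjm y ↦ ?_
  · rw [translate_apply]
    refine image_eq_zero_of_notMem_tsupport fun h ↦ hy ?_
    simpa using hmem hx (hθ h)
  · have : (translate θ x hxθ : Eucl n → ℝ) = fun y ↦ θ (y - x) := rfl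
    rw [this, iteratedFDeriv_comp_sub]
    exact hj j hjm _

lemma norm_iteratedFDeriv_scale_le (ε : EpsI) (φ : DR n) (j : ℕ) {B : ℝ}
    (h : ∀ z, ‖iteratedFDeriv ℝ j φ z‖ ≤ B) (z : Eucl n) :
    ‖iteratedFDeriv ℝ j (scale ε φ) z‖ ≤ B * (ε : ℝ) ^ (-(n + j : ℕ) : ℤ) := by
  have h1 : ContDiff ℝ j φ := φ.contDiff.of_le (by exact_mod_cast le_top)
  have h2 : ContDiff ℝ j fun x ↦ φ ((ε : ℝ)⁻¹ • x) := h1.comp (contDiff_const_smul _)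
  have e : (scale ε φ : Eucl n → ℝ) = fun x ↦ ((ε : ℝ) ^ n)⁻¹ • φ ((ε : ℝ)⁻¹ • x) := rfl
  have hε := ε.2.1
  rw [e, iteratedFDeriv_const_smul_apply' h2.contDiffAt, iteratedFDeriv_comp_const_smul _ h1,
    norm_smul, norm_smul, zpow_neg, zpow_natCast, pow_add, mul_inv, mul_comm B, mul_assoc,
    norm_inv, norm_pow, norm_pow, norm_inv, Real.norm_of_nonneg hε.le, inv_pow]
  gcongr
  exact h _

lemma tsupport_scale_subset (ε : EpsI) (φ : DR n) {r : ℝ}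
    (h : tsupport φ ⊆ Metric.closedBall 0 r) :
    tsupport (scale ε φ) ⊆ Metric.closedBall 0 (ε * r) := by
  have hε := ε.2.1
  intro x hx
  have h1 : x ∈ tsupport fun x ↦ φ ((ε : ℝ)⁻¹ • x) :=
    tsupport_mul_subset_right (f := fun _ ↦ ((ε : ℝ) ^ n)⁻¹) hx
  have h2 := h (tsupport_comp_subset_preimage φ (f := fun x ↦ (ε : ℝ)⁻¹ • x) (by fun_prop) h1)
  rw [mem_closedBall_zero_iff, norm_smul, norm_inv, Real.norm_of_nonneg hε.le,
    inv_mul_le_iff₀ hε] at h2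
  simpa using h2

end Pairing

/-! ### Pairings as smooth functions of the distribution -/

section DistributionPlots

variable {n k : ℕ} {Ω : Opens (Eucl n)}

/-- A distribution as a continuous linear functional. -/
def distCLM (u : 𝓓'(Ω, ℝ)) : 𝓓(Ω, ℝ) →L[ℝ] ℝ := ⟨u.toLinearMap, u.cont⟩

lemma pair_distCLM (u : 𝓓'(Ω, ℝ)) {θ : DR n} {x : Eucl n} (hx : x ∈ transDom Ω θ) :
    pair (distCLM u) θ x = u (translate θ x hx) := pair_of_mem _ hx

/-- The canonical diffeology tests only with functionals l, and each test is the smoothness of x ↦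
⟨l, θ(· - x)⟩. -/
lemma isPlot_translate (θ : DR n) {q : Eucl k → transDom Ω θ} (hq : IsPlot q) :
    IsPlot (fun s ↦ translate θ (q s : Eucl n) (q s).2) := fun l ↦ by
  have hq' : ContDiff ℝ ∞ fun s ↦ (q s : Eucl n) := IsPlot.contDiff hq
  have h := (contDiffOn_pair l θ).comp_contDiff hq' fun s ↦ (q s).2
  have e : pair l θ ∘ (fun s ↦ (q s : Eucl n)) = fun s ↦ l (translate θ (q s : Eucl n) (q s).2) :=
    funext fun s ↦ pair_of_mem l (q s).2
  exact e ▸ h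

/-- A plot of 𝓓'(Ω) is smooth in (t, χ) jointly; inserting the plot of translates for χ gives joint
smoothness in t and x. -/
lemma isPlot_pairFn (θ : DR n) {p : Eucl k → 𝓓'(Ω, ℝ)} (hp : IsPlot p) :
    IsPlot (fun t ↦ pairFn (distCLM (p t)) θ) := fun m q hq ↦ by
  have h : IsPlot fun s ↦ p (q s).1 (translate θ ((q s).2 : Eucl n) (q s).2.2) :=
    hp m (fun s ↦ ((q s).1, translate θ ((q s).2 : Eucl n) (q s).2.2))
      ⟨hq.1, isPlot_translate θ hq.2⟩
  have e : (fun s ↦ (pairFn (distCLM (p (q s).1)) θ).1 (q s).2)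
      = fun s ↦ p (q s).1 (translate θ ((q s).2 : Eucl n) (q s).2.2) :=
    funext fun s ↦ pair_distCLM _ (q s).2.2
  rw [← e] at h
  exact h

end DistributionPlots

/-! ### Moderateness of regularized distributions -/

section Moderateness

variable {n : ℕ} {Ω : Opens (Eucl n)}

lemma zpow_neg_le_zpow_neg (ε : EpsI) {N M : ℕ} (h : N ≤ M) :
    (ε : ℝ) ^ (-(N : ℤ)) ≤ (ε : ℝ) ^ (-(M : ℤ)) :=
  zpow_le_zpow_right_of_le_one₀ ε.2.1 ε.2.2 (by omega)

/-- One extra power of 1/ε absorbs any constant. -/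
lemma eventually_mul_zpow_neg_le (C : ℝ) (N : ℕ) :
    ∀ᶠ ε : EpsI in zeroI, C * (ε : ℝ) ^ (-(N : ℤ)) ≤ (ε : ℝ) ^ (-((N + 1 : ℕ) : ℤ)) := by
  have h : Tendsto (fun ε : EpsI ↦ C * (ε : ℝ)) zeroI (𝓝 0) := by
    simpa using tendsto_coe_zeroI.const_mul C
  filter_upwards [h.eventually_le_const one_pos] with ε hε
  have h0 := ε.2.1
  have e : (ε : ℝ) ^ (-(N : ℤ)) = (ε : ℝ) * (ε : ℝ) ^ (-((N + 1 : ℕ) : ℤ)) := by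
    rw [← zpow_one_add₀ h0.ne']
    congr 1
    push_cast
    ring
  rw [e, ← mul_assoc]
  exact mul_le_of_le_one_left (zpow_nonneg h0.le _) hε

/-- The pairing of a functional with the derivatives of translates of scaled test functions is
bounded by a power of the scaling parameter that depends on the compact set only. -/
lemma exists_abs_pair_wordPd_scale_le (L : 𝓓(Ω, ℝ) →L[ℝ] ℝ) {K : Set (Eucl n)} (hK : IsCompact K)
    (hKΩ : K ⊆ Ω) (l : List (Fin n)) : ∃ δ > 0, ∃ (m : ℕ) (C : ℝ), ∀ (ε : EpsI) (θ : DR n),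
      tsupport (scale ε θ) ⊆ Metric.closedBall 0 δ → ∀ x ∈ K, ∀ B : ℝ, 0 ≤ B →
        (∀ j ≤ m, ∀ z, ‖iteratedFDeriv ℝ j θ z‖ ≤ B) →
          |pair L (DR.wordPd l (scale ε θ)) x| ≤ C * (B * (ε : ℝ) ^ (-((n + m : ℕ) : ℤ))) := by
  obtain ⟨δ, hδ, m, C, hC0, h⟩ := exists_abs_pair_le L hK hKΩ
  refine ⟨δ, hδ, m + l.length, C, fun ε θ hθ x hx B hB hj ↦ ?_⟩
  have hε := ε.2.1
  refine (h _ ((DR.tsupport_wordPd_subset l _).trans hθ) x hx).2 _ (by positivity)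
    fun j hjm z ↦ DR.norm_iteratedFDeriv_wordPd_le l _ j (fun z ↦ ?_) z
  refine (norm_iteratedFDeriv_scale_le ε θ _ (hj _ (by omega)) z).trans ?_
  exact mul_le_mul_of_nonneg_left (zpow_neg_le_zpow_neg ε (by omega)) hB

lemma exists_iteratedFDeriv_le (φ : DR n) (m : ℕ) :
    ∃ B : ℝ, 0 ≤ B ∧ ∀ j ≤ m, ∀ z, ‖iteratedFDeriv ℝ j φ z‖ ≤ B := by
  choose B hB using fun j : ℕ ↦ Continuous.bounded_above_of_compact_support
    (φ.contDiff.continuous_iteratedFDeriv (m := j) (by exact_mod_cast le_top))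
    (φ.hasCompactSupport.iteratedFDeriv j)
  have hB0 (j : ℕ) : 0 ≤ B j := (norm_nonneg _).trans (hB j 0)
  refine ⟨∑ j ∈ Finset.range (m + 1), B j, Finset.sum_nonneg fun j _ ↦ hB0 j, fun j hj z ↦ ?_⟩
  exact (hB j z).trans
    (Finset.single_le_sum (fun j _ ↦ hB0 j) (Finset.mem_range.mpr (by omega)))

end Moderateness

/-! ### Distributions in the full algebra -/

section Full

variable {n : ℕ} {Ω : Opens (Eucl n)}

/-- The function `(φ, x) ↦ ⟨u, φ(· - x)⟩` of a distribution `u`. -/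
def distENet (u : 𝓓'(Ω, ℝ)) : ENets Ω := fun φ ↦ pairFn (distCLM u) φ.1

/-- The exponent n + m comes from u, K and α, before φ is chosen; only the constant and the
threshold for ε depend on φ. The domains match because `transDom Ω φ.1` and `dom Ω φ` unfold to the
same set. -/
lemma isModerateE_distENet (u : 𝓓'(Ω, ℝ)) : IsModerateE (distENet u) := by
  intro K hK hKΩ α
  obtain ⟨δ, hδ, m, C, h⟩ := exists_abs_pair_wordPd_scale_le (distCLM u) hK hKΩ (multiWord α)
  refine ⟨n + m, fun φ _ ↦ ?_⟩
  obtain ⟨B, hB0, hB⟩ := exists_iteratedFDeriv_le φ.1 m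
  obtain ⟨r, hr⟩ := φ.1.hasCompactSupport.isCompact.isBounded.subset_closedBall 0
  have hlim : Tendsto (fun ε : EpsI ↦ (ε : ℝ) * r) zeroI (𝓝 0) := by
    simpa using tendsto_coe_zeroI.mul_const r
  refine ⟨C * B, ?_⟩
  filter_upwards [hlim.eventually_le_const hδ] with ε hε x hx
  have h1 : ((distENet u).along φ ε) = pairFn (distCLM u) (scale ε φ.1) := rfl
  change |(mderiv α ((distENet u).along φ ε)).1 x| ≤ _
  rw [h1]
  refine (congrArg abs (mderiv_pairFn (distCLM u) (scale ε φ.1) α x)).trans_le ?_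
  rw [abs_mul, abs_pow, abs_neg, abs_one, one_pow, one_mul, mul_assoc]
  exact h ε φ.1 ((tsupport_scale_subset ε φ.1 hr).trans (Metric.closedBall_subset_closedBall hε))
    x hx B hB0 hB

/-- The canonical embedding of the distributions into the full algebra. -/
def iotaFull (u : 𝓓'(Ω, ℝ)) : GFull Ω := GFull.mk Ω ⟨distENet u, isModerateE_distENet u⟩

/-- The condition prescribes R at every point of U(Ω), since a test function is determined by its
values; the representative itself is unique. -/
lemma isIotaFull_iff (u : 𝓓'(Ω, ℝ)) (g : GFull Ω) : IsIotaFull u g ↔ g = iotaFull u := by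
  have hval (φ : A0 n) (x : dom Ω φ) :
      (distENet u φ).1 x = u (translate φ.1 (x : Eucl n) x.2) := pair_distCLM u x.2
  constructor
  · rintro ⟨R, rfl, hR⟩
    refine congrArg (GFull.mk Ω) (Subtype.ext (funext fun φ ↦ Subtype.ext (funext fun x ↦ ?_)))
    obtain ⟨χ, hχ, hRχ⟩ := hR φ x
    rw [hRχ]
    refine Eq.trans (congrArg u (TestFunction.ext fun y ↦ ?_)) (hval φ x).symm
    exact hχ y
  · rintro rfl
    exact ⟨_, rfl, fun φ x ↦ ⟨translate φ.1 (x : Eucl n) x.2, fun y ↦ rfl, hval φ x⟩⟩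

lemma dSmooth_iotaFull : DSmooth (iotaFull : 𝓓'(Ω, ℝ) → GFull Ω) := fun k p hp ↦
  dSmooth_GFull_mk Ω k (fun t ↦ ⟨distENet (p t), isModerateE_distENet (p t)⟩)
    ((isPlot_modE_iff _).mpr fun φ ↦ isPlot_pairFn φ.1 hp)

end Full

/-! ### Locality and cut-offs -/

section Locality

variable {n : ℕ} {O O' Ω : Opens (Eucl n)}

/-- Derivatives commute with restriction, and f and g have the same restriction to a neighbourhood
of x. -/
lemma mderiv_eq_of_eventuallyEq (α : Fin n → ℕ) (f : SmoothFn O) (g : SmoothFn O') {x : Eucl n}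
    (hx : x ∈ O) (hx' : x ∈ O') (h : ext f.1 =ᶠ[𝓝 x] ext g.1) :
    (mderiv α f).1 ⟨x, hx⟩ = (mderiv α g).1 ⟨x, hx'⟩ := by
  obtain ⟨V, hV, hVo, hxV⟩ := eventually_nhds_iff.mp
    (h.and (inter_mem (O.isOpen.mem_nhds hx) (O'.isOpen.mem_nhds hx')))
  let V' : Opens (Eucl n) := ⟨V, hVo⟩
  have hO : V' ≤ O := fun y hy ↦ (hV y hy).2.1
  have hO' : V' ≤ O' := fun y hy ↦ (hV y hy).2.2
  have e : restrictFn hO f = restrictFn hO' g := Subtype.ext (funext fun y ↦ by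
    have := (hV y y.2).1
    rwa [ext_of_mem _ (hO y.2), ext_of_mem _ (hO' y.2)] at this)
  have h1 : mderiv α (restrictFn hO f) = restrictFn hO (mderiv α f) :=
    congrFun (netDeriv_restrict (fun _ : Unit ↦ hO) α f) ()
  have h2 : mderiv α (restrictFn hO' g) = restrictFn hO' (mderiv α g) :=
    congrFun (netDeriv_restrict (fun _ : Unit ↦ hO') α g) ()
  have h3 : restrictFn hO (mderiv α f) = restrictFn hO' (mderiv α g) := by rw [← h1, ← h2, e]
  exact congrFun (congrArg Subtype.val h3) ⟨x, hxV⟩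

/-- A net that vanishes on every compact set for small parameters is negligible. -/
lemma isNegligibleS_of_eventually_eqOn_zero {w : SNets Ω}
    (h : ∀ K : Set (Eucl n), IsCompact K → K ⊆ Ω →
      ∀ᶠ ε in zeroI, ∀ x : Ω, (x : Eucl n) ∈ K → (w ε).1 x = 0) : IsNegligibleS w := by
  intro K hK hKΩ α m
  -- Vanishing on a thickening of K is vanishing near each point of K, which is what derivatives
  -- need.
  obtain ⟨δ, hδ, hδK⟩ := hK.exists_cthickening_subset_open Ω.isOpen hKΩ
  refine ⟨0, ?_⟩
  filter_upwards [h _ hK.cthickening hδK] with ε hε x hx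
  have h1 : ext (w ε).1 =ᶠ[𝓝 (x : Eucl n)] ext (0 : SmoothFn Ω).1 := by
    filter_upwards [Metric.closedBall_mem_nhds (x : Eucl n) hδ] with y hy
    have hyK := Metric.mem_cthickening_of_dist_le y x δ K hx hy
    rw [ext_of_mem _ (hδK hyK), ext_of_mem _ (hδK hyK), hε ⟨y, hδK hyK⟩ hyK]
    rfl
  have h2 := mderiv_eq_of_eventuallyEq α (w ε) 0 x.2 x.2 h1
  rw [map_zero] at h2
  change |(mderiv α (w ε)).1 ⟨x, x.2⟩| ≤ _
  rw [h2]
  simp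

lemma exists_contDiff_cutoff (O : Opens (Eucl n)) {L : Set (Eucl n)} (hL : IsClosed L)
    (hLO : L ⊆ O) : ∃ κ : Eucl n → ℝ, ContDiff ℝ ∞ κ ∧ (∀ x ∉ O, κ =ᶠ[𝓝 x] 0) ∧
      ∀ x ∈ L, κ =ᶠ[𝓝 x] 1 := by
  obtain ⟨κ, h0, h1, -⟩ := exists_contMDiffMap_zero_one_nhds_of_isClosed
    (modelWithCornersSelf ℝ (Eucl n)) (n := ⊤) O.isOpen.isClosed_compl hL
    (disjoint_compl_left_iff_subset.mpr hLO)
  exact ⟨κ, κ.contMDiff.contDiff, fun x hx ↦ eventually_nhdsSet_iff_forall.mp h0 x hx,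
    fun x hx ↦ eventually_nhdsSet_iff_forall.mp h1 x hx⟩

/-- Near a point with π w ∉ O the product is identically zero, whatever G does there. Taking π as
the identity treats single functions; the second projection treats plots. -/
lemma contDiff_cutoff_mul {W : Type*} [NormedAddCommGroup W] [NormedSpace ℝ W]
    {κ : Eucl n → ℝ} (hκ : ContDiff ℝ ∞ κ) (h0 : ∀ x ∉ O, κ =ᶠ[𝓝 x] 0) {π : W → Eucl n}
    (hπ : ContDiff ℝ ∞ π) {G : W → ℝ} (hG : ContDiffOn ℝ ∞ G {w | π w ∈ O}) :
    ContDiff ℝ ∞ fun w ↦ κ (π w) * G w := by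
  refine contDiff_iff_contDiffAt.mpr fun w ↦ ?_
  by_cases hw : π w ∈ O
  · have ho : IsOpen {w | π w ∈ O} := O.isOpen.preimage hπ.continuous
    exact (hκ.comp hπ).contDiffAt.mul (hG.contDiffAt (ho.mem_nhds hw))
  · refine (contDiffAt_const (c := (0 : ℝ))).congr_of_eventuallyEq ?_
    filter_upwards [hπ.continuous.continuousAt.eventually (h0 _ hw)] with y hy
    simp [hy]

variable (Ω) in
/-- The product of a smooth function on `O` and a cut-off function, as a smooth function on `Ω`. -/
def cutFn {κ : Eucl n → ℝ} (hκ : ContDiff ℝ ∞ κ) (h0 : ∀ x ∉ O, κ =ᶠ[𝓝 x] 0)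
    (f : SmoothFn O) : SmoothFn Ω :=
  ⟨fun x ↦ κ x * ext f.1 x, (contDiff_cutoff_mul hκ h0 contDiff_id f.2).contDiffOn.congr
    fun _ hx ↦ ext_of_mem _ hx⟩

lemma isPlot_cutFn {k : ℕ} {κ : Eucl n → ℝ} (hκ : ContDiff ℝ ∞ κ) (h0 : ∀ x ∉ O, κ =ᶠ[𝓝 x] 0)
    {p : Eucl k → SmoothFn O} (hp : IsPlot p) : IsPlot fun t ↦ cutFn Ω hκ h0 (p t) := by
  rw [isPlot_smoothFn_iff] at hp ⊢
  exact (contDiff_cutoff_mul hκ h0 contDiff_snd hp).contDiffOn.congr fun z hz ↦ ext_of_mem _ hz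

end Locality

/-! ### Nets of mollifiers -/

section Mollifiers

variable {n : ℕ}

lemma wordDeriv_toSmooth {J : Type*} (l : List (Fin n)) (θ : J → DR n) :
    (wordDeriv l fun j ↦ (θ j).toSmooth) = fun j ↦ (DR.wordPd l (θ j)).toSmooth := by
  induction l with
  | nil => rfl
  | cons i l ih =>
    have h1 (φ : DR n) : pderiv i φ.toSmooth = (φ.pd i).toSmooth := by
      have : ext φ.toSmooth.1 = φ := funext fun x ↦ ext_of_mem _ (Opens.mem_top x)
      refine Subtype.ext (funext fun x ↦ ?_)
      change fderiv ℝ (ext φ.toSmooth.1) x _ = _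
      rw [this]
      rfl
    change wordDeriv ([i] ++ l) _ = _
    rw [wordDeriv_append, ih]
    funext j
    simp [wordDeriv, h1, DR.wordPd]

/-- Since Dφ = ∑ ∂ᵢφ dxᵢ, bounds on partial derivatives become bounds on full ones; A depends only
on n. -/
lemma exists_norm_iteratedFDeriv_succ_le (n : ℕ) : ∃ A : ℝ, ∀ (φ : DR n) (j : ℕ) (z : Eucl n)
    (B : ℝ), (∀ i, ‖iteratedFDeriv ℝ j (φ.pd i) z‖ ≤ B) →
      ‖iteratedFDeriv ℝ (j + 1) φ z‖ ≤ A * B := by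
  let T (i : Fin n) : ℝ →L[ℝ] (Eucl n →L[ℝ] ℝ) :=
    (ContinuousLinearMap.id ℝ ℝ).smulRight (EuclideanSpace.proj i : Eucl n →L[ℝ] ℝ)
  refine ⟨∑ i, ‖T i‖, fun φ j z B hB ↦ ?_⟩
  have hsm (i : Fin n) : ContDiff ℝ j (φ.pd i) := (φ.pd i).contDiff.of_le (by exact_mod_cast le_top)
  have e : fderiv ℝ φ = fun z ↦ ∑ i, T i (φ.pd i z) := by
    funext z
    ext h
    rw [← DR.sum_mul_pd]
    simp [T, mul_comm]
  have hT (i : Fin n) : ContDiffAt ℝ j (fun z ↦ T i (φ.pd i z)) z :=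
    ((T i).contDiff.comp (hsm i)).contDiffAt
  rw [← norm_iteratedFDeriv_fderiv, e, Finset.sum_mul, iteratedFDeriv_fun_sum_apply fun i _ ↦ hT i]
  refine norm_sum_le_of_le _ fun i _ ↦ ?_
  refine ((T i).norm_iteratedFDeriv_comp_left (hsm i).contDiffAt le_rfl).trans ?_
  gcongr
  exact hB i

/-- Moderateness is given for partial derivatives, while the functionals are bounded through full
ones. Induction on the order, over all words, passes from one to the other. -/
lemma IsMollifierNet.exists_iteratedFDeriv_le {ψ : EpsI → DR n} (hψ : IsMollifierNet ψ) (m : ℕ) :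
    ∃ N : ℕ, ∀ᶠ ε : EpsI in zeroI, ∀ j ≤ m, ∀ z,
      ‖iteratedFDeriv ℝ j (ψ ε) z‖ ≤ (ε : ℝ) ^ (-(N : ℤ)) := by
  obtain ⟨A, hA⟩ := exists_norm_iteratedFDeriv_succ_le n
  have key (j : ℕ) : ∀ l : List (Fin n), ∃ N : ℕ, ∀ᶠ ε : EpsI in zeroI, ∀ z,
      ‖iteratedFDeriv ℝ j (DR.wordPd l (ψ ε)) z‖ ≤ (ε : ℝ) ^ (-(N : ℤ)) := by
    induction j with
    | zero =>
      intro l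
      obtain ⟨N, C, hC⟩ := (forall_netDeriv_iff
        (fun w ↦ ∃ N : ℕ, IsBigOOn univ w (-(N : ℤ))) _).mp hψ.moderate l
      refine ⟨N + 1, ?_⟩
      rw [wordDeriv_toSmooth] at hC
      filter_upwards [hC, eventually_mul_zpow_neg_le C N] with ε h1 h2 z
      rw [norm_iteratedFDeriv_zero]
      exact (h1 ⟨z, Opens.mem_top z⟩ (mem_univ _)).trans h2
    | succ j ih =>
      intro l
      choose N hN using fun i ↦ ih (i :: l)
      refine ⟨(∑ i, N i) + 1, ?_⟩
      filter_upwards [eventually_all.mpr hN, eventually_mul_zpow_neg_le A (∑ i, N i)]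
        with ε h1 h2 z
      refine (hA _ j z _ fun i ↦ (h1 i z).trans ?_).trans h2
      exact zpow_neg_le_zpow_neg ε (Finset.single_le_sum (fun _ _ ↦ zero_le) (Finset.mem_univ i))
  choose N hN using fun j ↦ key j []
  refine ⟨∑ j ∈ Finset.range (m + 1), N j, ?_⟩
  have hall : ∀ᶠ ε : EpsI in zeroI, ∀ j ∈ Finset.range (m + 1), ∀ z,
      ‖iteratedFDeriv ℝ j (ψ ε) z‖ ≤ (ε : ℝ) ^ (-(N j : ℤ)) :=
    (Finset.eventually_all _).mpr fun j _ ↦ hN j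
  filter_upwards [hall] with ε hε j hj z
  have hj' : j ∈ Finset.range (m + 1) := Finset.mem_range.mpr (by omega)
  exact (hε j hj' z).trans
    (zpow_neg_le_zpow_neg ε (Finset.single_le_sum (fun _ _ ↦ zero_le) hj'))

/-- The reflected test function `x ↦ φ(-x)`. -/
def DR.reflect (φ : DR n) : DR n where
  toFun x := φ ((-1 : ℝ) • x)
  contDiff' := φ.contDiff.comp (contDiff_const_smul _)
  hasCompactSupport' := φ.hasCompactSupport.comp_homeomorph
    (Homeomorph.smulOfNeZero (-1 : ℝ) (by norm_num))
  tsupport_subset' := fun _ _ ↦ trivial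

lemma DR.norm_iteratedFDeriv_reflect_le (φ : DR n) (j : ℕ) {B : ℝ}
    (h : ∀ z, ‖iteratedFDeriv ℝ j φ z‖ ≤ B) (z : Eucl n) :
    ‖iteratedFDeriv ℝ j φ.reflect z‖ ≤ B := by
  have h1 : ContDiff ℝ j φ := φ.contDiff.of_le (by exact_mod_cast le_top)
  have e : (φ.reflect : Eucl n → ℝ) = fun x ↦ φ ((-1 : ℝ) • x) := rfl
  rw [e, iteratedFDeriv_comp_const_smul _ h1, norm_smul]
  simpa using h _

lemma DR.tsupport_reflect_subset (φ : DR n) {r : ℝ} (h : tsupport φ ⊆ Metric.closedBall 0 r) :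
    tsupport φ.reflect ⊆ Metric.closedBall 0 r := fun x hx ↦ by
  have := h (tsupport_comp_subset_preimage φ (f := fun x ↦ (-1 : ℝ) • x) (by fun_prop) hx)
  simpa using this

/-- Writes the convolution kernel as a translate of a reflected test function, so that the results
on pairings apply. -/
lemma scale_reflect_apply (ε : EpsI) (φ : DR n) (x y : Eucl n) :
    scale ε φ.reflect (y - x) = scale ε φ (x - y) := by
  change _ * φ ((-1 : ℝ) • (ε : ℝ)⁻¹ • (y - x)) = _ * φ ((ε : ℝ)⁻¹ • (x - y))
  rw [smul_comm, neg_one_smul, neg_sub]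

end Mollifiers

/-! ### Distributions in the special algebra -/

section Special

variable {n : ℕ} {Ω : Opens (Eucl n)}

lemma eventually_notMem_thickening_compl {K : Set (Eucl n)} (hK : IsCompact K) (hKΩ : K ⊆ Ω) :
    ∀ᶠ ε : EpsI in zeroI, ∀ x ∈ K, x ∉ Metric.thickening (2 * ε) (Ω : Set (Eucl n))ᶜ := by
  obtain ⟨δ, hδ, hδK⟩ := hK.exists_cthickening_subset_open Ω.isOpen hKΩ
  have hlim : Tendsto (fun ε : EpsI ↦ 2 * (ε : ℝ)) zeroI (𝓝 0) := by
    simpa using tendsto_coe_zeroI.const_mul 2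
  filter_upwards [hlim.eventually_le_const hδ] with ε hε x hx hxt
  obtain ⟨z, hz, hxz⟩ := Metric.mem_thickening_iff.mp hxt
  exact hz (hδK (Metric.mem_cthickening_of_dist_le z x δ K hx
    (by rw [dist_comm]; exact hxz.le.trans hε)))

/-- A point at distance at least 2ε from the complement of Ω stays in Ω when moved by at most ε; the
factor 2 leaves room for the strict inequality in the thickening. -/
lemma compl_thickening_subset_transDom (ε : EpsI) {θ : DR n}
    (hθ : tsupport θ ⊆ Metric.closedBall 0 (ε : ℝ)) :
    (Metric.thickening (2 * ε) (Ω : Set (Eucl n))ᶜ)ᶜ ⊆ transDom Ω θ := by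
  have h0 := ε.2.1
  have key {x : Eucl n} (hx : x ∉ Metric.thickening (2 * ε) (Ω : Set (Eucl n))ᶜ) {y : Eucl n}
      (hy : ‖y‖ ≤ ε) : y + x ∈ Ω := by
    by_contra hyx
    exact hx (Metric.mem_thickening_iff.mpr ⟨y + x, hyx, by
      rw [dist_comm, dist_eq_norm, add_sub_cancel_right]; linarith⟩)
  intro x hx
  refine ⟨by simpa using key hx (y := 0) (by simpa using h0.le), fun y hy ↦ key hx ?_⟩
  simpa using hθ hy

variable (Ω) in
/-- Distributions on `Ω` are regularized by a net of mollifiers, smoothly in the distribution. -/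
lemma IsMollifierNet.exists_regularization {ψ : EpsI → DR n} (hψ : IsMollifierNet ψ) :
    ∃ v : 𝓓'(Ω, ℝ) → SNets Ω,
      (∀ (k : ℕ) (p : Eucl k → 𝓓'(Ω, ℝ)), IsPlot p → ∀ ε, IsPlot fun t ↦ v (p t) ε) ∧
      ∀ K : Set (Eucl n), IsCompact K → K ⊆ Ω → ∀ᶠ ε in zeroI, ∀ x ∈ K,
        x ∈ transDom Ω (scale ε (ψ ε).reflect) ∧ ∀ u, ext (v u ε).1 =ᶠ[𝓝 x]
          ext (pairFn (distCLM u) (scale ε (ψ ε).reflect)).1 := by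
  have hsupp (ε : EpsI) : tsupport (scale ε (ψ ε).reflect) ⊆ Metric.closedBall 0 (ε : ℝ) := by
    have h1 : tsupport (ψ ε) ⊆ Metric.closedBall 0 1 := fun x hx ↦ by
      simpa using (hψ.supp ε x hx).le
    simpa using tsupport_scale_subset ε _ ((ψ ε).tsupport_reflect_subset h1)
  -- The cut-offs depend on ε but not on u, so multiplying by them preserves plots in u.
  choose κ hκ h0 h1 using fun ε : EpsI ↦ exists_contDiff_cutoff
    (transDom Ω (scale ε (ψ ε).reflect)) Metric.isOpen_thickening.isClosed_compl
    (compl_thickening_subset_transDom (Ω := Ω) ε (hsupp ε))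
  refine ⟨fun u ε ↦ cutFn Ω (hκ ε) (h0 ε) (pairFn (distCLM u) _),
    fun k p hp ε ↦ isPlot_cutFn (hκ ε) (h0 ε) (isPlot_pairFn _ hp), fun K hK hKΩ ↦ ?_⟩
  filter_upwards [eventually_notMem_thickening_compl hK hKΩ] with ε hε x hx
  have hx' := compl_thickening_subset_transDom (Ω := Ω) ε (hsupp ε) (hε x hx)
  refine ⟨hx', fun u ↦ ?_⟩
  filter_upwards [h1 ε x (hε x hx), Ω.isOpen.mem_nhds (hKΩ hx)] with y hy hyΩ
  rw [ext_of_mem _ hyΩ]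
  change κ ε y * _ = _
  rw [hy, Pi.one_apply, one_mul]

lemma IsMollifierNet.isModerateS_of_eventuallyEq {ψ : EpsI → DR n} (hψ : IsMollifierNet ψ)
    (u : 𝓓'(Ω, ℝ)) {v : SNets Ω}
    (hv : ∀ K : Set (Eucl n), IsCompact K → K ⊆ Ω → ∀ᶠ ε in zeroI, ∀ x ∈ K,
      x ∈ transDom Ω (scale ε (ψ ε).reflect) ∧ ext (v ε).1 =ᶠ[𝓝 x]
        ext (pairFn (distCLM u) (scale ε (ψ ε).reflect)).1) : IsModerateS v := by
  intro K hK hKΩ α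
  obtain ⟨δ, hδ, m, C, h⟩ := exists_abs_pair_wordPd_scale_le (distCLM u) hK hKΩ (multiWord α)
  obtain ⟨N, hN⟩ := hψ.exists_iteratedFDeriv_le m
  -- N is the growth of the derivatives of ψ_ε up to order m, and n + m is the cost of scaling.
  refine ⟨N + (n + m), C, ?_⟩
  filter_upwards [hv K hK hKΩ, hN, tendsto_coe_zeroI.eventually_le_const hδ]
    with ε h1 h2 h3 x hx
  obtain ⟨hxd, hxe⟩ := h1 x hx
  have hε := ε.2.1
  have h4 : tsupport (ψ ε) ⊆ Metric.closedBall 0 1 := fun x hx ↦ by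
    simpa using (hψ.supp ε x hx).le
  have h5 := (tsupport_scale_subset ε _ ((ψ ε).tsupport_reflect_subset h4)).trans
    (Metric.closedBall_subset_closedBall (by simpa using h3))
  change |(mderiv α (v ε)).1 ⟨x, x.2⟩| ≤ _
  rw [mderiv_eq_of_eventuallyEq α _ _ x.2 hxd hxe, mderiv_pairFn, abs_mul, abs_pow, abs_neg,
    abs_one, one_pow, one_mul, Nat.cast_add N, neg_add, zpow_add₀ hε.ne']
  exact h ε _ h5 x hx _ (by positivity) fun j hj z ↦
    (ψ ε).norm_iteratedFDeriv_reflect_le j (h2 j hj) z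

/-- On a compact set and for small ε both representatives pair u with the same test function, so
their difference vanishes there. -/
lemma IsIotaSpecial.eq {ψ : EpsI → DR n} {u : 𝓓'(Ω, ℝ)} {g g' : GSpecial Ω}
    (h : IsIotaSpecial ψ u g) (h' : IsIotaSpecial ψ u g') : g = g' := by
  obtain ⟨v, rfl, hv⟩ := h
  obtain ⟨v', rfl, hv'⟩ := h'
  refine GSpecial.mk_eq_mk_iff.mpr (isNegligibleS_of_eventually_eqOn_zero fun K hK hKΩ ↦ ?_)
  filter_upwards [hv K hK hKΩ, hv' K hK hKΩ] with ε h1 h2 x hx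
  obtain ⟨χ, hχ, e⟩ := h1 x hx
  obtain ⟨χ', hχ', e'⟩ := h2 x hx
  have : χ = χ' := TestFunction.ext fun y ↦ (hχ y).trans (hχ' y).symm
  change (v.1 ε).1 x - (v'.1 ε).1 x = 0
  rw [e, e', this, sub_self]

lemma IsMollifierNet.exists_iotaSpecial {ψ : EpsI → DR n} (hψ : IsMollifierNet ψ) :
    ∃ ι : 𝓓'(Ω, ℝ) → GSpecial Ω, (∀ u g, IsIotaSpecial ψ u g ↔ g = ι u) ∧ DSmooth ι := by
  obtain ⟨v, hplot, hv⟩ := hψ.exists_regularization Ω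
  have hm (u : 𝓓'(Ω, ℝ)) : IsModerateS (v u) := hψ.isModerateS_of_eventuallyEq u
    fun K hK hKΩ ↦ (hv K hK hKΩ).mono fun ε h x hx ↦ ⟨(h x hx).1, (h x hx).2 u⟩
  have hι (u : 𝓓'(Ω, ℝ)) : IsIotaSpecial ψ u (GSpecial.mk Ω ⟨v u, hm u⟩) := by
    refine ⟨_, rfl, fun K hK hKΩ ↦ ?_⟩
    filter_upwards [hv K hK hKΩ] with ε h x hx
    obtain ⟨hxd, hxe⟩ := h x hx
    refine ⟨translate _ (x : Eucl n) hxd, fun y ↦ scale_reflect_apply ε (ψ ε) x y, ?_⟩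
    have := (hxe u).self_of_nhds
    rw [ext_of_mem _ x.2, ext_of_mem _ hxd] at this
    exact this.trans (pair_distCLM u hxd)
  refine ⟨_, fun u g ↦ ⟨fun h ↦ h.eq (hι u), fun h ↦ h ▸ hι u⟩, fun k p hp ↦ ?_⟩
  exact dSmooth_GSpecial_mk Ω k (fun t ↦ ⟨v (p t), hm (p t)⟩)
    ((isPlot_modS_iff _).mpr (hplot k p hp))

end Special

end Colombeau
end
-- The theorem
open Colombeau in
theorem mainTheorem4 (n : ℕ) (Ω : Opens (Eucl n)) :
    -- sum, product and derivations of the special Colombeau algebra are smooth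
    (DSmooth (fun p : GSpecial Ω × GSpecial Ω ↦ p.1 + p.2) ∧
      DSmooth (fun p : GSpecial Ω × GSpecial Ω ↦ p.1 * p.2) ∧
      ∀ α : Fin n → ℕ, DSmooth (GSpecial.deriv Ω α)) ∧
    -- sum, product and derivations of the full Colombeau algebra are smooth
    (DSmooth (fun p : GFull Ω × GFull Ω ↦ p.1 + p.2) ∧
      DSmooth (fun p : GFull Ω × GFull Ω ↦ p.1 * p.2) ∧
      ∀ α : Fin n → ℕ, DSmooth (GFull.deriv Ω α)) ∧
    -- with the D-topology, both are topological algebras with continuous derivations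
    (@IsTopologicalRing (GSpecial Ω) dTopology _ ∧
      @ContinuousSMul ℝ (GSpecial Ω) _ _ dTopology ∧
      ∀ α : Fin n → ℕ, Continuous[dTopology, dTopology] (GSpecial.deriv Ω α)) ∧
    (@IsTopologicalRing (GFull Ω) dTopology _ ∧
      @ContinuousSMul ℝ (GFull Ω) _ _ dTopology ∧
      ∀ α : Fin n → ℕ, Continuous[dTopology, dTopology] (GFull.deriv Ω α)) ∧
    -- the embeddings of the distributions are well defined and smooth
    (∀ ψ : EpsI → DR n, IsMollifierNet ψ →
      ∃ ι : 𝓓'(Ω, ℝ) → GSpecial Ω, (∀ u g, IsIotaSpecial ψ u g ↔ g = ι u) ∧ DSmooth ι) ∧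
    (∃ ι : 𝓓'(Ω, ℝ) → GFull Ω, (∀ u g, IsIotaFull u g ↔ g = ι u) ∧ DSmooth ι) ∧
    -- the embeddings of the smooth functions are smooth
    DSmooth (sigmaSpecial : SmoothFn Ω → GSpecial Ω) ∧
    DSmooth (sigmaFull : SmoothFn Ω → GFull Ω) :=
  ⟨⟨GSpecial.dSmooth_add Ω, GSpecial.dSmooth_mul Ω, GSpecial.dSmooth_deriv Ω⟩,
    ⟨GFull.dSmooth_add Ω, GFull.dSmooth_mul Ω, GFull.dSmooth_deriv Ω⟩,
    ⟨GSpecial.isTopologicalRing Ω, GSpecial.continuousSMul Ω,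
      -- For a map of one variable smoothness does imply continuity in the D-topologies.
      fun α ↦ (GSpecial.dSmooth_deriv Ω α).continuous⟩,
    ⟨(GFull.isTopologicalAlgebra Ω).1, (GFull.isTopologicalAlgebra Ω).2,
      fun α ↦ (GFull.dSmooth_deriv Ω α).continuous⟩,
    fun _ hψ ↦ hψ.exists_iotaSpecial,
    ⟨iotaFull, isIotaFull_iff, dSmooth_iotaFull⟩,
    dSmooth_sigmaSpecial Ω, dSmooth_sigmaFull Ω⟩
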